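/- For an integer $n\ge 2$ let $\mathcal M_n\subseteq\mathbb R^{\binom n2}$ be the metric polytope, that is, the set of all arrays $(d_{ij})$ of real numbers indexed by the unordered pairs of distinct elements $i,j\in\{1,\dots,n\}$ such that $0<d_{ij}\le 2$ for all $i\ne j$ and $d_{ij}\le d_{ik}+d_{kj}$ for all pairwise distinct $i,j,k$ (the metrics on $n$ points with diameter at most $2$). Let $\mathrm{Vol}$ denote the Lebesgue measure on $\mathbb R^{\binom n2}$. Then there are an absolute constant $C$ and a sequence $\varepsilon_n\to 0$ (as $n\to\infty$) such that, for all $n\ge 2$, $$\exp\big((1/6-\varepsilon_n)\,n^{3/2}\big)\le \mathrm{Vol}(\mathcal M_n)\le \exp\big(C\,n^{3/2}\big).$$ -/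

import Mathlib

open Filter Topology MeasureTheory

/-- The unordered pairs of distinct elements of an `n`-point set. -/
abbrev PointPair (n : ℕ) : Type := {e : Sym2 (Fin n) // ¬ e.IsDiag}

/-- The unordered pair `{i, j}` with `i ≠ j`. -/
def pointPair {n : ℕ} {i j : Fin n} (h : i ≠ j) : PointPair n :=
  ⟨s(i, j), fun hd => h (Sym2.mk_isDiag_iff.mp hd)⟩

/-- The cone of all metrics on `n` points: arrays of positive distances, one for each unordered
pair of distinct points, that satisfy all triangle inequalities. (The triangle inequalities for
indices that are not pairwise distinct hold automatically, so they are not listed.) -/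
def metricCone (n : ℕ) : Set (PointPair n → ℝ) :=
  {d | (∀ e, 0 < d e) ∧
    ∀ (i j k : Fin n) (hij : i ≠ j) (hik : i ≠ k) (hkj : k ≠ j),
      d (pointPair hij) ≤ d (pointPair hik) + d (pointPair hkj)}

/-- The metric polytope: metrics on `n` points with diameter at most `2`. -/
def metricPolytope (n : ℕ) : Set (PointPair n → ℝ) :=
  {d | d ∈ metricCone n ∧ ∀ e, d e ≤ 2}

/-!
Both bounds compare the metric polytope with the cube `[1, 2]^{n choose 2}` it contains.

**Lower bound.** In the box `(1 - δ, 2]^{n choose 2}` with `δ = 1 / (2 √n)`, a given triangle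
inequality fails with probability at most `4 δ³ / 3` (`uniformIoc_prod_lt_le`), and this event is
independent of those of all but `O(n)` other triangles. By the Lovász local lemma
(`pow_card_le_measure_avoid`) the probability that no inequality fails is about
`exp (-(2 / 3) δ³ n³)`, while the volume of the box is about `exp (δ n² / 2)`; the product is
`exp (n^{3/2} / 6)` up to lower order terms (`exp_le_volume_metricPolytope`).

**Upper bound.** Rounding distances up to multiples of `1 / N` preserves the triangle inequality,
so it suffices to count integer metrics with distances at most `2N`, for `N = n`
(`volume_metricPolytope_le_card`). Take one uniformly at random. Let `h k` be the entropy of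
`d(x, y)` conditional on all distances within `A ∪ {x}` and within `A ∪ {y}`, where `A` is a set of
`k` points. By symmetry it depends on `k` only, and it is nonincreasing. Revealing the distances in
lexicographic order, the entropy of the whole metric is at most `∑ (n - 1 - k) h k`
(`IntMetric.log_card_le`), so it is enough to show `h k ≤ log N + O(1 / √k)`
(`IntMetric.pairEntropy_le_sqrt`).

As `d(x, y)` lies between the gap `D = max_{a ∈ A} |d(x, a) - d(y, a)|` and `2N`, we have
`h k - log N ≤ u k := 1 - E D / N` (up to `1 / N`). When a point `v` is added to `A`, the gap becomes
the maximum of `D` and `|d(x, v) - d(y, v)|`. The two new distances have conditional entropies at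
least `h (k + 1)`, and their conditional mutual information is at most `h k - h (k + 1)`. Now two
independent variables of entropy at least `log N` cannot stay within `D` of each other: this is a
stable form of the fact that if all cross distances between two intervals are at most `D`, then
their mean length is at most `D` (`sum_negMulLog_add_le`, a Gibbs inequality with weights
read off from the tails of the two laws). It follows that the gap grows on average by a multiple of
`N (u k)³`, up to an error given by the mutual information (`tangent_sub_mutualSum_le`,
`IntMetric.tangent_sub_le_gap`). So `v k = u k + (h k - log N)` satisfies
`v (k + 1) ≤ v k - c (v k)³`, which gives `v k = O(1 / √k)`.
-/

/-! ### Entropy of two laws whose opposite tails do not meet -/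

lemma log_one_add_pow_four_le {v : ℝ} (hv : 0 ≤ v) :
    Real.log (1 + v ^ 4) ≤ 16 * v ^ 3 / (1 + v) ^ 2 := by
  rw [le_div_iff₀ (by positivity)]
  rcases le_total v 1 with h | h
  · have h1 : Real.log (1 + v ^ 4) ≤ v ^ 4 := by
      have := Real.log_le_sub_one_of_pos (show 0 < 1 + v ^ 4 by positivity)
      linarith
    have h2 : v * (1 + v) ^ 2 ≤ 16 := by nlinarith [mul_nonneg hv hv]
    calc Real.log (1 + v ^ 4) * (1 + v) ^ 2 ≤ v ^ 4 * (1 + v) ^ 2 := by gcongr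
      _ = v ^ 3 * (v * (1 + v) ^ 2) := by ring
      _ ≤ v ^ 3 * 16 := by gcongr
      _ = 16 * v ^ 3 := by ring
  · have h1 : Real.log (1 + v ^ 4) ≤ 4 * v := by
      calc Real.log (1 + v ^ 4) ≤ Real.log ((1 + v) ^ 4) := by
            apply Real.log_le_log (by positivity)
            nlinarith [pow_nonneg hv 2, pow_nonneg hv 3]
        _ = 4 * Real.log (1 + v) := by rw [Real.log_pow]; norm_num
        _ ≤ 4 * v := by
            have := Real.log_le_sub_one_of_pos (show 0 < 1 + v by positivity)
            linarith
    calc Real.log (1 + v ^ 4) * (1 + v) ^ 2 ≤ 4 * v * (2 * v) ^ 2 := by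
          gcongr
          linarith
      _ = 16 * v ^ 3 := by ring

/-- Tangent-line form of the concavity of `t ↦ 32 b² √t / (√t + b)`, a primitive of a function
that dominates `t ↦ log (1 + b⁴ / t²)`. -/
lemma sub_mul_log_le {b s t : ℝ} (hb : 0 < b) (hs : 0 ≤ s) (hst : s ≤ t) :
    (t - s) * Real.log (1 + b ^ 4 / t ^ 2) ≤
      32 * b ^ 2 * (√t / (√t + b)) - 32 * b ^ 2 * (√s / (√s + b)) := by
  rcases (hs.trans hst).eq_or_lt with h0 | ht
  · have : s = 0 := le_antisymm (hst.trans h0.symm.le) hs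
    subst this; simp [← h0]
  have hr : 0 < √t := Real.sqrt_pos.2 ht
  have hq : 0 ≤ √s := Real.sqrt_nonneg s
  have hqr : √s ≤ √t := Real.sqrt_le_sqrt hst
  have et : t = √t ^ 2 := (Real.sq_sqrt ht.le).symm
  have es : s = √s ^ 2 := (Real.sq_sqrt hs).symm
  generalize √t = r at *
  generalize √s = q at *
  subst et es
  have h1 : Real.log (1 + b ^ 4 / (r ^ 2) ^ 2) ≤ 16 * b ^ 3 / (r * (r + b) ^ 2) := by
    have := log_one_add_pow_four_le (v := b / r) (by positivity)
    have e1 : (b / r) ^ 4 = b ^ 4 / (r ^ 2) ^ 2 := by rw [div_pow]; ring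
    have e2 : 16 * (b / r) ^ 3 / (1 + b / r) ^ 2 = 16 * b ^ 3 / (r * (r + b) ^ 2) := by
      field_simp
    rwa [e1, e2] at this
  have h2 : r / (r + b) - q / (q + b) = b * (r - q) / ((r + b) * (q + b)) := by
    field_simp; ring
  rw [← mul_sub, h2]
  calc (r ^ 2 - q ^ 2) * Real.log (1 + b ^ 4 / (r ^ 2) ^ 2)
      ≤ (r ^ 2 - q ^ 2) * (16 * b ^ 3 / (r * (r + b) ^ 2)) :=
        mul_le_mul_of_nonneg_left h1 (by linarith)
    _ = 16 * b ^ 3 * (r - q) / (r + b) * ((r + q) / (r * (r + b))) := by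
        field_simp; ring
    _ ≤ 16 * b ^ 3 * (r - q) / (r + b) * (2 / (q + b)) := by
        have : 0 ≤ r - q := by linarith
        refine mul_le_mul_of_nonneg_left ?_ (by positivity)
        rw [div_le_div_iff₀ (by positivity) (by positivity)]
        nlinarith [mul_nonneg hr.le (sub_nonneg.2 hqr), mul_nonneg hb.le (sub_nonneg.2 hqr),
          mul_nonneg hq (sub_nonneg.2 hqr)]
    _ = 32 * b ^ 2 * (b * (r - q) / ((r + b) * (q + b))) := by
        field_simp; ring

/-- The upper tail `∑_{x ≤ y < m} f y` of a weight function on `{0, …, m - 1}`. -/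
def upperTail (m : ℕ) (f : ℕ → ℝ) (x : ℕ) : ℝ := ∑ y ∈ Finset.Ico x m, f y

/-- The lower tail `∑_{y ≤ x} f y` of a weight function. -/
def lowerTail (f : ℕ → ℝ) (x : ℕ) : ℝ := ∑ y ∈ Finset.range (x + 1), f y

section Tails

variable {m : ℕ} {f g : ℕ → ℝ}

lemma upperTail_nonneg (hf : ∀ x, 0 ≤ f x) (x : ℕ) : 0 ≤ upperTail m f x :=
  Finset.sum_nonneg fun _ _ => hf _

lemma le_upperTail (hf : ∀ x, 0 ≤ f x) {x : ℕ} (hx : x < m) : f x ≤ upperTail m f x :=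
  Finset.single_le_sum (f := f) (fun _ _ => hf _) (Finset.mem_Ico.2 ⟨le_rfl, hx⟩)

lemma le_lowerTail (hf : ∀ x, 0 ≤ f x) (x : ℕ) : f x ≤ lowerTail f x :=
  Finset.single_le_sum (f := f) (fun _ _ => hf _) (Finset.self_mem_range_succ x)

lemma upperTail_eq_add {x : ℕ} (hx : x < m) :
    upperTail m f x = f x + upperTail m f (x + 1) :=
  Finset.sum_eq_sum_Ico_succ_bot hx f

lemma one_le_upperTail_add_lowerTail (hf : ∀ x, 0 ≤ f x) (h1 : ∑ x ∈ Finset.range m, f x = 1)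
    {x : ℕ} (hx : x < m) : 1 ≤ upperTail m f x + lowerTail f x := by
  have h := Finset.sum_range_add_sum_Ico f hx.le
  have := hf x
  rw [upperTail, lowerTail, Finset.sum_range_succ]
  linarith

/-- If `Y` has law `f` then `upperTail m f Y` is stochastically at least uniform on `[0, 1]`, so
this is a discrete form of `∫₀¹ log (1 + b⁴ / t²) dt = O(b²)`. -/
lemma sum_mul_log_upperTail_le (hf : ∀ x, 0 ≤ f x) {b : ℝ} (hb : 0 < b) :
    ∑ x ∈ Finset.range m, f x * Real.log (1 + b ^ 4 / upperTail m f x ^ 2) ≤ 32 * b ^ 2 := by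
  set Φ : ℕ → ℝ := fun x => 32 * b ^ 2 * (√(upperTail m f x) / (√(upperTail m f x) + b)) with hΦ
  calc _ ≤ ∑ x ∈ Finset.range m, (Φ x - Φ (x + 1)) := by
        refine Finset.sum_le_sum fun x hx => ?_
        have e := upperTail_eq_add (f := f) (Finset.mem_range.1 hx)
        have := sub_mul_log_le hb (upperTail_nonneg (m := m) hf (x + 1))
          (show upperTail m f (x + 1) ≤ upperTail m f x by linarith [hf x])
        rwa [show upperTail m f x - upperTail m f (x + 1) = f x by linarith] at this
    _ = Φ 0 - Φ m := Finset.sum_range_sub' _ _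
    _ ≤ 32 * b ^ 2 := by
        have h0 : 0 ≤ Φ m := by positivity
        have h1 : √(upperTail m f 0) / (√(upperTail m f 0) + b) ≤ 1 :=
          div_le_one_of_le₀ (by linarith) (by positivity)
        have : Φ 0 ≤ 32 * b ^ 2 * 1 := mul_le_mul_of_nonneg_left h1 (by positivity)
        linarith

lemma sum_mul_log_lowerTail_le (hf : ∀ x, 0 ≤ f x) {b : ℝ} (hb : 0 < b) :
    ∑ x ∈ Finset.range m, f x * Real.log (1 + b ^ 4 / lowerTail f x ^ 2) ≤ 32 * b ^ 2 := by
  set F : ℕ → ℝ := fun x => ∑ y ∈ Finset.range x, f y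
  have hF : ∀ x, 0 ≤ F x := fun x => Finset.sum_nonneg fun _ _ => hf _
  set Φ : ℕ → ℝ := fun x => 32 * b ^ 2 * (√(F x) / (√(F x) + b)) with hΦ
  calc _ ≤ ∑ x ∈ Finset.range m, (Φ (x + 1) - Φ x) := by
        refine Finset.sum_le_sum fun x hx => ?_
        have e : F (x + 1) = F x + f x := Finset.sum_range_succ _ _
        have := sub_mul_log_le hb (hF x) (show F x ≤ F (x + 1) by linarith [hf x])
        rwa [show F (x + 1) - F x = f x by linarith] at this
    _ = Φ m - Φ 0 := Finset.sum_range_sub _ _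
    _ ≤ 32 * b ^ 2 := by
        have h0 : 0 ≤ Φ 0 := by positivity
        have h1 : √(F m) / (√(F m) + b) ≤ 1 :=
          div_le_one_of_le₀ (by linarith) (by positivity)
        have : Φ m ≤ 32 * b ^ 2 * 1 := mul_le_mul_of_nonneg_left h1 (by positivity)
        linarith

/-- Gibbs' inequality against the (not normalised) density `w / N`. -/
lemma sum_negMulLog_le (hf : ∀ x, 0 ≤ f x) (h1 : ∑ x ∈ Finset.range m, f x = 1)
    {w : ℕ → ℝ} (hw : ∀ x, 0 ≤ w x) (hw' : ∀ x < m, 0 < f x → 0 < w x) {N : ℝ} (hN : 0 < N) :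
    ∑ x ∈ Finset.range m, Real.negMulLog (f x) ≤
      (∑ x ∈ Finset.range m, w x) / N - 1 + Real.log N
        - ∑ x ∈ Finset.range m, f x * Real.log (w x) := by
  have key : ∀ x ∈ Finset.range m, Real.negMulLog (f x) ≤
      w x / N - f x + f x * Real.log N - f x * Real.log (w x) := by
    intro x hx
    rcases (hf x).eq_or_lt with h | h
    · simp only [← h, Real.negMulLog_zero, zero_mul, sub_zero, add_zero]
      exact div_nonneg (hw x) hN.le
    · have hwx := hw' x (Finset.mem_range.1 hx) h
      have h2 := Real.log_le_sub_one_of_pos (show 0 < w x / (N * f x) by positivity)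
      rw [Real.log_div hwx.ne' (by positivity), Real.log_mul hN.ne' h.ne'] at h2
      have h3 := mul_le_mul_of_nonneg_left h2 h.le
      have h4 : f x * (w x / (N * f x) - 1) = w x / N - f x := by field_simp
      rw [Real.negMulLog]
      linarith
  refine (Finset.sum_le_sum key).trans (le_of_eq ?_)
  rw [Finset.sum_sub_distrib, Finset.sum_add_distrib, Finset.sum_sub_distrib, ← Finset.sum_mul,
    h1, ← Finset.sum_div]
  ring

/-- The density used to bound the entropy of a law `f` on `{0, …, m - 1}` whose lower tail is
opposed, at distance `D`, to the upper tail of `g`. It is close to `1` in the bulk of `f`, and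
decays at the right end with the upper tail of `f` and at the left end with the inverse of the
upper tail of `g`. -/
noncomputable def gibbsWeight (m : ℕ) (f g : ℕ → ℝ) (D : ℕ) (β : ℝ) (x : ℕ) : ℝ :=
  upperTail m f x ^ 2 / (upperTail m f x ^ 2 + β) * (β / (upperTail m g (x + D) ^ 2 + β))

lemma sum_negMulLog_le_gibbsWeight (hf : ∀ x, 0 ≤ f x) (h1 : ∑ x ∈ Finset.range m, f x = 1)
    (hg : ∀ x, 0 ≤ g x) {D : ℕ} {b N : ℝ} (hb : 0 < b) (hN : 0 < N)
    (h : ∀ y, upperTail m g (y + D) * lowerTail f y ≤ b ^ 4) :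
    ∑ x ∈ Finset.range m, Real.negMulLog (f x) ≤
      (∑ x ∈ Finset.range m, gibbsWeight m f g D (b ^ 4) x) / N - 1 + Real.log N + 64 * b ^ 2 := by
  have hb4 : 0 < b ^ 4 := by positivity
  refine (sum_negMulLog_le (w := gibbsWeight m f g D (b ^ 4)) hf h1 (fun x => ?_)
    (fun x hx hfx => ?_) hN).trans ?_
  · unfold gibbsWeight; positivity
  · have : 0 < upperTail m f x := hfx.trans_le (le_upperTail hf hx)
    unfold gibbsWeight; positivity
  have key : ∀ x ∈ Finset.range m, -(f x * Real.log (gibbsWeight m f g D (b ^ 4) x)) ≤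
      f x * Real.log (1 + b ^ 4 / upperTail m f x ^ 2)
        + f x * Real.log (1 + b ^ 4 / lowerTail f x ^ 2) := by
    intro x hx
    rcases (hf x).eq_or_lt with h0 | h0
    · simp [← h0]
    have hT : 0 < upperTail m f x := h0.trans_le (le_upperTail hf (Finset.mem_range.1 hx))
    have hG : 0 < lowerTail f x := h0.trans_le (le_lowerTail hf x)
    have hT2 := upperTail_nonneg (m := m) hg (x + D)
    rw [← mul_neg, ← mul_add]
    refine mul_le_mul_of_nonneg_left ?_ h0.le
    rw [gibbsWeight, Real.log_mul (by positivity) (by positivity), neg_add, ← Real.log_inv,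
      ← Real.log_inv]
    refine add_le_add (le_of_eq ?_) (Real.log_le_log (by positivity) ?_)
    · congr 1; field_simp
    · have : (b ^ 4 / (upperTail m g (x + D) ^ 2 + b ^ 4))⁻¹
          = 1 + upperTail m g (x + D) ^ 2 / b ^ 4 := by field_simp; ring
      rw [this]
      gcongr 1 + ?_
      rw [div_le_div_iff₀ hb4 (by positivity), ← mul_pow, ← sq]
      exact pow_le_pow_left₀ (by positivity) (h x) 2
  have := Finset.sum_le_sum key
  rw [Finset.sum_add_distrib, Finset.sum_neg_distrib] at this
  have h2 := sum_mul_log_upperTail_le (m := m) hf hb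
  have h3 := sum_mul_log_lowerTail_le (m := m) hf hb
  linarith

lemma sum_range_sub_shift_le {a : ℕ → ℝ} (h0 : ∀ x, 0 ≤ a x) (h1 : ∀ x, a x ≤ 1) (m D : ℕ) :
    ∑ x ∈ Finset.range m, (a x - a (x + D)) ≤ D := by
  have e : ∑ x ∈ Finset.range m, a x + ∑ x ∈ Finset.range D, a (m + x)
      = ∑ x ∈ Finset.range D, a x + ∑ x ∈ Finset.range m, a (x + D) := by
    rw [← Finset.sum_range_add, add_comm m D, Finset.sum_range_add]
    simp_rw [add_comm D]
  have h2 : ∑ x ∈ Finset.range D, a x ≤ D := by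
    simpa using Finset.sum_le_sum (fun x (_ : x ∈ Finset.range D) => h1 x)
  have h3 : 0 ≤ ∑ x ∈ Finset.range D, a (m + x) := Finset.sum_nonneg fun _ _ => h0 _
  rw [Finset.sum_sub_distrib]
  linarith

/-- The two ends of a law cannot both be light at the same point, so the two factors of
`gibbsWeight` do not both deviate from `1`. -/
lemma gibbsWeight_le (hf : ∀ x, 0 ≤ f x) (h1 : ∑ x ∈ Finset.range m, f x = 1)
    (hg : ∀ x, 0 ≤ g x) {D : ℕ} {β : ℝ} (hβ : 0 < β)
    (h : ∀ y, upperTail m g (y + D) * lowerTail f y ≤ β) {x : ℕ} (hx : x < m) :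
    gibbsWeight m f g D β x ≤ upperTail m f x ^ 2 / (upperTail m f x ^ 2 + β)
      - upperTail m g (x + D) ^ 2 / (upperTail m g (x + D) ^ 2 + β) + 4 * β := by
  have hT := upperTail_nonneg (m := m) hf x
  have hT2 := upperTail_nonneg (m := m) hg (x + D)
  have hTG := one_le_upperTail_add_lowerTail hf h1 hx
  have hh := h x
  unfold gibbsWeight
  generalize upperTail m f x = T at *
  generalize upperTail m g (x + D) = U at *
  generalize lowerTail f x = G at *
  have e1 : β / (U ^ 2 + β) = 1 - U ^ 2 / (U ^ 2 + β) := by field_simp; ring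
  have e2 : T ^ 2 / (T ^ 2 + β) = 1 - β / (T ^ 2 + β) := by field_simp; ring
  have b1 : U ^ 2 / (U ^ 2 + β) ≤ 1 := div_le_one_of_le₀ (by linarith) (by positivity)
  have b2 : β / (T ^ 2 + β) ≤ 1 := div_le_one_of_le₀ (by nlinarith) (by positivity)
  have p1 : 0 ≤ U ^ 2 / (U ^ 2 + β) := by positivity
  have p2 : 0 ≤ β / (T ^ 2 + β) := by positivity
  have key : β / (T ^ 2 + β) * (U ^ 2 / (U ^ 2 + β)) ≤ 4 * β := by
    rcases le_total (1 / 2) T with h2 | h2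
    · have : β / (T ^ 2 + β) ≤ 4 * β := by
        rw [div_le_iff₀ (by positivity)]
        nlinarith [mul_nonneg hβ.le (show 0 ≤ T ^ 2 - 1 / 4 by nlinarith), mul_pos hβ hβ]
      nlinarith
    · have hG : 1 / 2 ≤ G := by linarith
      have hU : U ≤ 2 * β := by nlinarith
      have : U ^ 2 / (U ^ 2 + β) ≤ 4 * β := by
        rw [div_le_iff₀ (by positivity)]
        nlinarith [mul_nonneg hβ.le (sq_nonneg U), mul_nonneg hT2 (sub_nonneg.2 hU)]
      nlinarith
  rw [e1, e2]
  nlinarith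

/-- If two laws on `{0, …, 2N}` have no opposite tails, of product at least `b⁴`, at distance `D`
from each other, then the mean of their entropies is at most `log N + (D / N - 1) + O(b²)`. This
is a stable form of the fact that two intervals all whose cross distances are at most `D` have
mean length at most `D`. -/
theorem sum_negMulLog_add_le {N D : ℕ} (hN : 0 < N) {f g : ℕ → ℝ}
    (hf : ∀ x, 0 ≤ f x) (hf1 : ∑ x ∈ Finset.range (2 * N + 1), f x = 1)
    (hg : ∀ x, 0 ≤ g x) (hg1 : ∑ x ∈ Finset.range (2 * N + 1), g x = 1) {b : ℝ} (hb : 0 < b)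
    (hfg : ∀ y, upperTail (2 * N + 1) f (y + D) * lowerTail g y ≤ b ^ 4)
    (hgf : ∀ y, upperTail (2 * N + 1) g (y + D) * lowerTail f y ≤ b ^ 4) :
    ∑ x ∈ Finset.range (2 * N + 1), Real.negMulLog (f x)
      + ∑ x ∈ Finset.range (2 * N + 1), Real.negMulLog (g x) ≤
      2 * Real.log N + 2 * (D / N) - 2 + 24 * b ^ 4 + 128 * b ^ 2 := by
  set m := 2 * N + 1 with hm
  have hNR : (0 : ℝ) < N := by exact_mod_cast hN
  have hN1 : (1 : ℝ) ≤ N := by exact_mod_cast hN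
  have hb4 : 0 < b ^ 4 := by positivity
  have hF := sum_negMulLog_le_gibbsWeight hf hf1 hg hb hNR hgf
  have hG := sum_negMulLog_le_gibbsWeight hg hg1 hf hb hNR hfg
  have hZ : ∑ x ∈ Finset.range m, gibbsWeight m f g D (b ^ 4) x
      + ∑ x ∈ Finset.range m, gibbsWeight m g f D (b ^ 4) x ≤ 2 * D + 8 * b ^ 4 * m := by
    set a : ℕ → ℝ := fun x => upperTail m f x ^ 2 / (upperTail m f x ^ 2 + b ^ 4) with ha
    set a' : ℕ → ℝ := fun x => upperTail m g x ^ 2 / (upperTail m g x ^ 2 + b ^ 4) with ha'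
    have s1 := sum_range_sub_shift_le (a := a) (fun x => by positivity)
      (fun x => div_le_one_of_le₀ (by linarith) (by positivity)) m D
    have s2 := sum_range_sub_shift_le (a := a') (fun x => by positivity)
      (fun x => div_le_one_of_le₀ (by linarith) (by positivity)) m D
    calc _ ≤ ∑ x ∈ Finset.range m, (a x - a' (x + D) + 4 * b ^ 4)
          + ∑ x ∈ Finset.range m, (a' x - a (x + D) + 4 * b ^ 4) := by
          refine add_le_add (Finset.sum_le_sum fun x hx => ?_) (Finset.sum_le_sum fun x hx => ?_)
          · exact gibbsWeight_le hf hf1 hg hb4 hgf (Finset.mem_range.1 hx)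
          · exact gibbsWeight_le hg hg1 hf hb4 hfg (Finset.mem_range.1 hx)
      _ ≤ 2 * D + 8 * b ^ 4 * m := by
          simp only [Finset.sum_add_distrib, Finset.sum_sub_distrib, Finset.sum_const,
            Finset.card_range, nsmul_eq_mul] at s1 s2 ⊢
          linarith
  have hm3 : (m : ℝ) ≤ 3 * N := by rw [hm]; push_cast; linarith
  have hZN : (∑ x ∈ Finset.range m, gibbsWeight m f g D (b ^ 4) x) / N
      + (∑ x ∈ Finset.range m, gibbsWeight m g f D (b ^ 4) x) / N ≤
      2 * (D / N) + 24 * b ^ 4 := by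
    rw [← add_div, div_le_iff₀ hNR]
    have : (2 * ((D : ℝ) / N) + 24 * b ^ 4) * N = 2 * D + 8 * b ^ 4 * (3 * N) := by field_simp; ring
    rw [this]
    refine hZ.trans ?_
    gcongr
  linarith

end Tails

/-! ### Entropy on a finite set -/

section FiniteEntropy

variable {Ω α β γ : Type*}

open Classical in
/-- The size, as a real number, of the part of `S` on which `X` agrees with `X ω`. In terms of the
uniform law on `S`, this is `|S| · P(X = X ω)`. -/
noncomputable def fiberCard (S : Finset Ω) (X : Ω → α) (ω : Ω) : ℝ :=
  ((S.filter fun ω' => X ω' = X ω).card : ℝ)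

lemma fiberCard_pos {S : Finset Ω} {X : Ω → α} {ω : Ω} (h : ω ∈ S) : 0 < fiberCard S X ω := by
  classical
  have : 0 < (S.filter fun ω' => X ω' = X ω).card :=
    Finset.card_pos.2 ⟨ω, Finset.mem_filter.2 ⟨h, rfl⟩⟩
  unfold fiberCard
  exact_mod_cast this

lemma fiberCard_congr {S : Finset Ω} {X : Ω → α} {Y : Ω → β}
    (h : ∀ ω ω', X ω = X ω' ↔ Y ω = Y ω') (ω : Ω) : fiberCard S X ω = fiberCard S Y ω := by
  classical
  unfold fiberCard
  simp_rw [h]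

lemma fiberCard_eq_card {S : Finset Ω} {X : Ω → α} {ω : Ω} (h : ∀ ω' ∈ S, X ω' = X ω) :
    fiberCard S X ω = S.card := by
  classical
  unfold fiberCard
  rw [Finset.filter_true_of_mem h]

lemma fiberCard_eq_one {S : Finset Ω} {X : Ω → α} {ω : Ω} (hω : ω ∈ S)
    (h : ∀ ω' ∈ S, X ω' = X ω → ω' = ω) : fiberCard S X ω = 1 := by
  classical
  rw [fiberCard, Nat.cast_eq_one, Finset.card_eq_one]
  refine ⟨ω, ?_⟩
  ext ω'
  rw [Finset.mem_filter, Finset.mem_singleton]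
  exact ⟨fun h' => h ω' h'.1 h'.2, fun h' => by rw [h']; exact ⟨hω, rfl⟩⟩

lemma sum_div_fiberCard_le {S : Finset Ω} {X : Ω → α} {K : Finset α}
    (hK : ∀ ω ∈ S, X ω ∈ K) {F : α → ℝ} (hF : ∀ x ∈ K, 0 ≤ F x) :
    ∑ ω ∈ S, F (X ω) / fiberCard S X ω ≤ ∑ x ∈ K, F x := by
  classical
  rw [← Finset.sum_fiberwise_of_maps_to hK]
  refine Finset.sum_le_sum fun x hx => ?_
  have : ∀ ω ∈ S.filter (fun ω => X ω = x), F (X ω) / fiberCard S X ω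
      = F x / ((S.filter fun ω => X ω = x).card : ℝ) := by
    intro ω hω
    have hωx := (Finset.mem_filter.1 hω).2
    simp only [fiberCard, hωx]
  rw [Finset.sum_congr rfl this, Finset.sum_const, nsmul_eq_mul]
  rcases Nat.eq_zero_or_pos (S.filter fun ω => X ω = x).card with h | h
  · simpa [h] using hF x hx
  · have : ((S.filter fun ω => X ω = x).card : ℝ) ≠ 0 := by positivity
    rw [mul_div_cancel₀ _ this]

/-- `|S|` times the entropy of `X` under the uniform law on `S`. -/
noncomputable def entropySum (S : Finset Ω) (X : Ω → α) : ℝ :=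
  ∑ ω ∈ S, Real.log (S.card / fiberCard S X ω)

/-- `|S|` times the mutual information of `X` and `Y` under the uniform law on `S`. -/
noncomputable def mutualSum (S : Finset Ω) (X : Ω → α) (Y : Ω → β) : ℝ :=
  ∑ ω ∈ S, Real.log (fiberCard S (fun ω => (X ω, Y ω)) ω * S.card
    / (fiberCard S X ω * fiberCard S Y ω))

lemma entropySum_le {S : Finset Ω} {X : Ω → α} {K : Finset α} (hK : ∀ ω ∈ S, X ω ∈ K)
    {N : ℝ} (hN : 0 < N) :
    entropySum S X ≤ S.card * (Real.log N + K.card / N - 1) := by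
  have key : ∀ ω ∈ S, Real.log (S.card / fiberCard S X ω) ≤
      Real.log N - 1 + (S.card / N) / fiberCard S X ω := by
    intro ω hω
    have hS : (0 : ℝ) < S.card := by exact_mod_cast Finset.card_pos.2 ⟨ω, hω⟩
    have hc := fiberCard_pos (X := X) hω
    have h := Real.log_le_sub_one_of_pos (show 0 < S.card / N / fiberCard S X ω by positivity)
    rw [div_right_comm, Real.log_div (by positivity) hN.ne'] at h
    rw [div_right_comm _ N]
    linarith
  refine (Finset.sum_le_sum key).trans ?_
  have h := sum_div_fiberCard_le hK (F := fun _ => (S.card : ℝ) / N) (fun _ _ => by positivity)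
  rw [Finset.sum_add_distrib]
  simp only [Finset.sum_const, nsmul_eq_mul] at h ⊢
  have e : (K.card : ℝ) * (S.card / N) = S.card * (K.card / N) := by ring
  rw [e] at h
  linarith

/-- The mutual information of `X` and `Y` bounds the amount by which the joint probability of a
rectangle can fall short of half its product probability: the Donsker--Varadhan inequality for
minus the indicator function of the rectangle. -/
lemma half_mul_div_sub_mutualSum_le (S : Finset Ω) (X : Ω → α) (Y : Ω → β)
    (A : α → Prop) (B : β → Prop) [DecidablePred A] [DecidablePred B] :
    ((S.filter fun ω => A (X ω)).card : ℝ) * (S.filter fun ω => B (Y ω)).card / (2 * S.card)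
      - mutualSum S X Y ≤ (S.filter fun ω => A (X ω) ∧ B (Y ω)).card := by
  classical
  rcases S.eq_empty_or_nonempty with rfl | hS
  · simp [mutualSum]
  have hM : (0 : ℝ) < S.card := by exact_mod_cast hS.card_pos
  set a : α → ℝ := fun x => if A x then 1 else 0 with ha
  set b : β → ℝ := fun y => if B y then 1 else 0 with hb
  have hab : ∀ x y, a x * b y = 0 ∨ a x * b y = 1 := by
    intro x y; by_cases h : A x <;> by_cases h' : B y <;> simp [ha, hb, h, h']
  set Z : Ω → α × β := fun ω => (X ω, Y ω) with hZ
  set F : α × β → ℝ := fun p => ((S.filter fun ω' => X ω' = p.1).card : ℝ)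
    * (S.filter fun ω' => Y ω' = p.2).card * (1 - a p.1 * b p.2 / 2) / S.card with hF
  have hFnn : ∀ p, 0 ≤ F p := by
    intro p
    have : 0 ≤ 1 - a p.1 * b p.2 / 2 := by rcases hab p.1 p.2 with h | h <;> rw [h] <;> norm_num
    positivity
  have key : ∀ ω ∈ S, -Real.log (fiberCard S Z ω * S.card / (fiberCard S X ω * fiberCard S Y ω))
      - a (X ω) * b (Y ω) ≤ F (Z ω) / fiberCard S Z ω - 1 := by
    intro ω hω
    have hx := fiberCard_pos (X := X) hω
    have hy := fiberCard_pos (X := Y) hω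
    have hz := fiberCard_pos (X := Z) hω
    have h := Real.log_le_sub_one_of_pos (show 0 < fiberCard S X ω * fiberCard S Y ω /
      (fiberCard S Z ω * S.card) * Real.exp (-(a (X ω) * b (Y ω))) by positivity)
    rw [Real.log_mul (by positivity) (by positivity), Real.log_exp, ← inv_div, Real.log_inv] at h
    have hexp : Real.exp (-(a (X ω) * b (Y ω))) ≤ 1 - a (X ω) * b (Y ω) / 2 := by
      rcases hab (X ω) (Y ω) with h | h <;> rw [h]
      · simp
      · rw [Real.exp_neg, inv_le_comm₀ (by positivity) (by norm_num)]
        have := Real.add_one_le_exp (1 : ℝ)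
        norm_num at this ⊢
        linarith
    have hFe : F (Z ω) / fiberCard S Z ω = (fiberCard S Z ω * S.card /
        (fiberCard S X ω * fiberCard S Y ω))⁻¹ * (1 - a (X ω) * b (Y ω) / 2) := by
      have : F (Z ω) = fiberCard S X ω * fiberCard S Y ω * (1 - a (X ω) * b (Y ω) / 2) / S.card :=
        rfl
      rw [this]
      field_simp
    have hmul := mul_le_mul_of_nonneg_left hexp (show 0 ≤ (fiberCard S Z ω * S.card /
        (fiberCard S X ω * fiberCard S Y ω))⁻¹ by positivity)
    rw [hFe]
    linarith
  have hsum := Finset.sum_le_sum key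
  have hF2 := sum_div_fiberCard_le (S := S) (X := Z) (K := S.image X ×ˢ S.image Y) (F := F)
    (fun ω hω => Finset.mem_product.2 ⟨Finset.mem_image_of_mem _ hω, Finset.mem_image_of_mem _ hω⟩)
    (fun p _ => hFnn p)
  have sX : ∀ φ : α → ℝ, ∑ x ∈ S.image X, ((S.filter fun ω' => X ω' = x).card : ℝ) * φ x
      = ∑ ω ∈ S, φ (X ω) := by
    intro φ
    rw [← Finset.sum_fiberwise_of_maps_to (fun ω hω => Finset.mem_image_of_mem X hω)]
    refine Finset.sum_congr rfl fun x _ => ?_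
    rw [Finset.sum_congr rfl (fun ω hω => by rw [(Finset.mem_filter.1 hω).2]), Finset.sum_const,
      nsmul_eq_mul]
  have sY : ∀ φ : β → ℝ, ∑ x ∈ S.image Y, ((S.filter fun ω' => Y ω' = x).card : ℝ) * φ x
      = ∑ ω ∈ S, φ (Y ω) := by
    intro φ
    rw [← Finset.sum_fiberwise_of_maps_to (fun ω hω => Finset.mem_image_of_mem Y hω)]
    refine Finset.sum_congr rfl fun x _ => ?_
    rw [Finset.sum_congr rfl (fun ω hω => by rw [(Finset.mem_filter.1 hω).2]), Finset.sum_const,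
      nsmul_eq_mul]
  have hF3 : ∑ p ∈ S.image X ×ˢ S.image Y, F p = S.card - ((S.filter fun ω => A (X ω)).card : ℝ)
      * (S.filter fun ω => B (Y ω)).card / (2 * S.card) := by
    have e1 : ∀ x, ∑ y ∈ S.image Y, F (x, y) = ((S.filter fun ω' => X ω' = x).card : ℝ) *
        ((S.card - a x * (S.filter fun ω => B (Y ω)).card / 2) / S.card) := by
      intro x
      have e2 : ∀ y, F (x, y) = ((S.filter fun ω' => Y ω' = y).card : ℝ) *
          (((S.filter fun ω' => X ω' = x).card : ℝ) * (1 - a x * b y / 2) / S.card) := by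
        intro y; simp only [hF]; ring
      rw [Finset.sum_congr rfl fun y _ => e2 y, sY, ← Finset.sum_div, ← Finset.mul_sum,
        Finset.sum_sub_distrib, ← Finset.sum_div, ← Finset.mul_sum]
      simp [hb, mul_div_assoc]
    rw [Finset.sum_product, Finset.sum_congr rfl fun x _ => e1 x, sX, ← Finset.sum_div,
      Finset.sum_sub_distrib, ← Finset.sum_div, ← Finset.sum_mul]
    simp only [ha, Finset.sum_boole, Finset.sum_const, nsmul_eq_mul]
    field_simp
  have hcard : ∑ ω ∈ S, a (X ω) * b (Y ω)
      = ((S.filter fun ω => A (X ω) ∧ B (Y ω)).card : ℝ) := by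
    rw [← Finset.sum_boole]
    refine Finset.sum_congr rfl fun ω _ => ?_
    by_cases h : A (X ω) <;> by_cases h' : B (Y ω) <;> simp [ha, hb, h, h']
  rw [Finset.sum_sub_distrib, Finset.sum_sub_distrib, Finset.sum_neg_distrib, hcard] at hsum
  simp only [Finset.sum_const, nsmul_eq_mul, mul_one] at hsum
  have : mutualSum S X Y = ∑ ω ∈ S, Real.log (fiberCard S Z ω * S.card
    / (fiberCard S X ω * fiberCard S Y ω)) := rfl
  linarith

lemma mutualSum_nonneg (S : Finset Ω) (X : Ω → α) (Y : Ω → β) : 0 ≤ mutualSum S X Y := by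
  have := half_mul_div_sub_mutualSum_le S X Y (fun _ => False) (fun _ => False)
  simp only [Finset.filter_false, Finset.card_empty, Nat.cast_zero, false_and, zero_mul,
    zero_div] at this
  linarith

/-- The law of `X` under the uniform law on `S`. -/
noncomputable def uniformLaw (S : Finset Ω) (X : Ω → ℕ) (x : ℕ) : ℝ :=
  ((S.filter fun ω => X ω = x).card : ℝ) / S.card

lemma uniformLaw_nonneg (S : Finset Ω) (X : Ω → ℕ) (x : ℕ) : 0 ≤ uniformLaw S X x := by
  unfold uniformLaw; positivity

lemma sum_uniformLaw (S : Finset Ω) (X : Ω → ℕ) (K : Finset ℕ) :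
    ∑ x ∈ K, uniformLaw S X x = ((S.filter fun ω => X ω ∈ K).card : ℝ) / S.card := by
  unfold uniformLaw
  rw [← Finset.sum_div, Finset.card_eq_sum_card_fiberwise (f := X) (t := K)
    (s := S.filter fun ω => X ω ∈ K) (fun ω hω => (Finset.mem_filter.1 hω).2)]
  push_cast
  congr 1
  refine Finset.sum_congr rfl fun x hx => ?_
  congr 2
  ext ω
  simp only [Finset.mem_filter]
  constructor
  · rintro ⟨h, rfl⟩; exact ⟨⟨h, hx⟩, rfl⟩
  · rintro ⟨⟨h, -⟩, h'⟩; exact ⟨h, h'⟩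

lemma sum_negMulLog_uniformLaw {S : Finset Ω} (hS : S.Nonempty) {X : Ω → ℕ} {m : ℕ}
    (hX : ∀ ω ∈ S, X ω < m) :
    S.card * ∑ x ∈ Finset.range m, Real.negMulLog (uniformLaw S X x) = entropySum S X := by
  classical
  have hM : (0 : ℝ) < S.card := by exact_mod_cast hS.card_pos
  rw [entropySum, ← Finset.sum_fiberwise_of_maps_to (fun ω hω => Finset.mem_range.2 (hX ω hω)),
    Finset.mul_sum]
  refine Finset.sum_congr rfl fun x _ => ?_
  have : ∀ ω ∈ S.filter (fun ω => X ω = x), Real.log (S.card / fiberCard S X ω)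
      = -Real.log (uniformLaw S X x) := by
    intro ω hω
    rw [← Real.log_inv, uniformLaw, inv_div, fiberCard, (Finset.mem_filter.1 hω).2]
    congr!
  rw [Finset.sum_congr rfl this, Finset.sum_const, nsmul_eq_mul, Real.negMulLog]
  have e : ((S.filter fun ω => X ω = x).card : ℝ) = S.card * uniformLaw S X x := by
    unfold uniformLaw; field_simp
  rw [e]
  ring

/-- Let `Y₁, Y₂ ≤ 2N` have entropies whose mean exceeds `log N + (D / N - 1)` by `u`, on the
uniform probability space `S`. If they are independent then `|Y₁ - Y₂|` exceeds `D` by a multiple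
of `N u` with probability at least a multiple of `u²`; if not, an error bounded by their mutual
information appears. The lower bound `u³` is replaced by its tangent at `t`, so that the
inequality is linear in the entropies and can be summed over conditional laws. -/
theorem tangent_sub_mutualSum_le {S : Finset Ω} (hS : S.Nonempty) {N : ℕ} (hN : 0 < N)
    {Y₁ Y₂ : Ω → ℕ} (h₁ : ∀ ω ∈ S, Y₁ ω ≤ 2 * N) (h₂ : ∀ ω ∈ S, Y₂ ω ≤ 2 * N) (D : ℕ)
    {t : ℝ} (ht : 0 ≤ t) :
    (3 * t ^ 2 * (S.card * (1 - Real.log N - (D + 1) / N)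
        + (entropySum S Y₁ + entropySum S Y₂) / 2) - 2 * t ^ 3 * S.card) / 2 ^ 17
      - mutualSum S Y₁ Y₂ ≤
    ∑ ω ∈ S, (((max D ((Y₁ ω : ℤ) - Y₂ ω).natAbs : ℕ) : ℝ) - D) / N := by
  classical
  have hM : (0 : ℝ) < S.card := by exact_mod_cast hS.card_pos
  have hNR : (0 : ℝ) < N := by exact_mod_cast hN
  have hJ := mutualSum_nonneg S Y₁ Y₂
  have hnn : ∀ ω ∈ S, 0 ≤ (((max D ((Y₁ ω : ℤ) - Y₂ ω).natAbs : ℕ) : ℝ) - D) / N := by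
    intro ω _
    have : (D : ℝ) ≤ (max D ((Y₁ ω : ℤ) - Y₂ ω).natAbs : ℕ) := by exact_mod_cast le_max_left _ _
    exact div_nonneg (by linarith) hNR.le
  obtain ⟨u, hu⟩ : ∃ u : ℝ, u * S.card = S.card * (1 - Real.log N - (D + 1) / N)
      + (entropySum S Y₁ + entropySum S Y₂) / 2 := ⟨_, div_mul_cancel₀ _ hM.ne'⟩
  rw [← hu]
  rcases le_or_gt u 0 with hu0 | hu0
  · have h1 : 0 ≤ t ^ 2 * S.card * -u := by
      have := neg_nonneg.2 hu0
      positivity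
    have h2 : 0 ≤ t ^ 3 * S.card := by positivity
    have h3 := Finset.sum_nonneg hnn
    linarith
  have hm₁ : ∀ ω ∈ S, Y₁ ω < 2 * N + 1 := fun ω hω => Nat.lt_succ_of_le (h₁ ω hω)
  have hm₂ : ∀ ω ∈ S, Y₂ ω < 2 * N + 1 := fun ω hω => Nat.lt_succ_of_le (h₂ ω hω)
  have e₁ := sum_negMulLog_uniformLaw hS hm₁
  have e₂ := sum_negMulLog_uniformLaw hS hm₂
  have hu3 : u ≤ 3 := by
    have a1 := entropySum_le (K := Finset.range (2 * N + 1)) (fun ω hω => Finset.mem_range.2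
      (hm₁ ω hω)) hNR
    have a2 := entropySum_le (K := Finset.range (2 * N + 1)) (fun ω hω => Finset.mem_range.2
      (hm₂ ω hω)) hNR
    have a3 : ((Finset.range (2 * N + 1)).card : ℝ) / N ≤ 3 := by
      rw [div_le_iff₀ hNR, Finset.card_range]
      have : (1 : ℝ) ≤ N := by exact_mod_cast hN
      push_cast
      linarith
    have a4 : 0 ≤ ((D : ℝ) + 1) / N := by positivity
    refine le_of_mul_le_mul_right ?_ hM
    rw [hu]
    nlinarith
  -- The shift exceeds `D` by about `N u / 4`, and `b⁴ = (u / 128)²`.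
  set D' : ℕ := D + ⌈N * u / 4⌉₊ with hD'
  set b : ℝ := √(u / 128) with hb
  have hb0 : 0 < b := Real.sqrt_pos.2 (by positivity)
  have hb2 : b ^ 2 = u / 128 := Real.sq_sqrt (by positivity)
  have hb4 : b ^ 4 = u ^ 2 / 2 ^ 14 := by
    rw [show b ^ 4 = (b ^ 2) ^ 2 by ring, hb2]; ring
  have hDlow : N * u / 4 ≤ (D' : ℝ) - D := by
    rw [hD']; push_cast; linarith [Nat.le_ceil (N * u / 4)]
  have hDup : (D' : ℝ) - D ≤ N * u / 4 + 1 := by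
    rw [hD']; push_cast; linarith [(Nat.ceil_lt_add_one (show 0 ≤ N * u / 4 by positivity)).le]
  -- It is enough to find a rectangle of large product probability on which the gap is `≥ D'`.
  have main : ∀ (A B : ℕ → Prop) (_ : DecidablePred A) (_ : DecidablePred B),
      (∀ x y, A x → B y → D' ≤ ((x : ℤ) - y).natAbs) →
      b ^ 4 < ((S.filter fun ω => A (Y₁ ω)).card : ℝ) / S.card *
        (((S.filter fun ω => B (Y₂ ω)).card : ℝ) / S.card) →
      (3 * t ^ 2 * (u * S.card) - 2 * t ^ 3 * S.card) / 2 ^ 17 - mutualSum S Y₁ Y₂ ≤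
        ∑ ω ∈ S, (((max D ((Y₁ ω : ℤ) - Y₂ ω).natAbs : ℕ) : ℝ) - D) / N := by
    intro A B _ _ hAB hprod
    have hq := half_mul_div_sub_mutualSum_le S Y₁ Y₂ A B
    set q : ℝ := ((S.filter fun ω => A (Y₁ ω) ∧ B (Y₂ ω)).card : ℝ) with hqdef
    have hlow : u ^ 2 / 2 ^ 15 * S.card - mutualSum S Y₁ Y₂ ≤ q := by
      refine le_trans (sub_le_sub_right ?_ _) hq
      have : u ^ 2 / 2 ^ 15 * S.card = b ^ 4 * (S.card / 2) := by rw [hb4]; ring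
      rw [this]
      refine (mul_le_mul_of_nonneg_right hprod.le (by positivity)).trans (le_of_eq ?_)
      field_simp
    have hgain : u / 4 * q ≤
        ∑ ω ∈ S, (((max D ((Y₁ ω : ℤ) - Y₂ ω).natAbs : ℕ) : ℝ) - D) / N := by
      refine le_trans ?_ (Finset.sum_le_sum_of_subset_of_nonneg
        (Finset.filter_subset (fun ω => A (Y₁ ω) ∧ B (Y₂ ω)) S) fun ω hω _ => hnn ω hω)
      rw [mul_comm, hqdef, ← nsmul_eq_mul]
      refine Finset.card_nsmul_le_sum _ _ _ fun ω hω => ?_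
      obtain ⟨-, hA, hB⟩ := Finset.mem_filter.1 hω
      have : (D' : ℝ) ≤ (max D ((Y₁ ω : ℤ) - Y₂ ω).natAbs : ℕ) := by
        exact_mod_cast (hAB _ _ hA hB).trans (le_max_right _ _)
      rw [le_div_iff₀ hNR]
      linarith
    have h1 := mul_le_mul_of_nonneg_left hlow (show 0 ≤ u / 4 by positivity)
    have h2 : u / 4 * mutualSum S Y₁ Y₂ ≤ 1 * mutualSum S Y₁ Y₂ := by
      gcongr; linarith
    have h3 : 3 * t ^ 2 * u - 2 * t ^ 3 ≤ u ^ 3 := by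
      nlinarith [mul_nonneg (sq_nonneg (u - t)) (show 0 ≤ u + 2 * t by positivity)]
    have h4 := mul_le_mul_of_nonneg_right h3 hM.le
    linarith
  by_contra hcon
  have hle : ∀ (A B : ℕ → Prop) (_ : DecidablePred A) (_ : DecidablePred B),
      (∀ x y, A x → B y → D' ≤ ((x : ℤ) - y).natAbs) →
      ((S.filter fun ω => A (Y₁ ω)).card : ℝ) / S.card *
        (((S.filter fun ω => B (Y₂ ω)).card : ℝ) / S.card) ≤ b ^ 4 := by
    intro A B i j hAB
    by_contra h
    exact hcon (main A B i j hAB (not_le.1 h))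
  have hup : ∀ Y : Ω → ℕ, (∀ ω ∈ S, Y ω < 2 * N + 1) → ∀ x,
      upperTail (2 * N + 1) (uniformLaw S Y) x
        = ((S.filter fun ω => x ≤ Y ω).card : ℝ) / S.card := by
    intro Y hY x
    rw [upperTail, sum_uniformLaw]
    congr 3
    refine Finset.filter_congr fun ω hω => ?_
    have := hY ω hω
    rw [Finset.mem_Ico]
    omega
  have hdown : ∀ (Y : Ω → ℕ) (x : ℕ), lowerTail (uniformLaw S Y) x
        = ((S.filter fun ω => Y ω ≤ x).card : ℝ) / S.card := by
    intro Y x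
    rw [lowerTail, sum_uniformLaw]
    simp only [Finset.mem_range, Nat.lt_succ_iff]
  have hsum1 : ∀ Y : Ω → ℕ, (∀ ω ∈ S, Y ω < 2 * N + 1) →
      ∑ x ∈ Finset.range (2 * N + 1), uniformLaw S Y x = 1 := by
    intro Y hY
    rw [sum_uniformLaw, Finset.filter_true_of_mem fun ω hω => Finset.mem_range.2 (hY ω hω),
      div_self hM.ne']
  have hent := sum_negMulLog_add_le hN (D := D') (uniformLaw_nonneg S Y₁) (hsum1 Y₁ hm₁)
    (uniformLaw_nonneg S Y₂) (hsum1 Y₂ hm₂) hb0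
    (fun y => by
      rw [hup Y₁ hm₁, hdown]
      exact hle (fun x => y + D' ≤ x) (fun x => x ≤ y) _ _ fun x x' h h' => by omega)
    (fun y => by
      rw [hup Y₂ hm₂, hdown, mul_comm]
      exact hle (fun x => x ≤ y) (fun x => y + D' ≤ x) _ _ fun x x' h h' => by omega)
  have hu' : u * S.card ≤ S.card * ((D' - D - 1) / N + 12 * b ^ 4 + 64 * b ^ 2) := by
    rw [hu, ← e₁, ← e₂, ← mul_add, mul_div_assoc, ← mul_add]
    refine mul_le_mul_of_nonneg_left ?_ hM.le
    have : ((D' : ℝ) - D - 1) / N = D' / N - (D + 1) / N := by ring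
    rw [this]
    linarith
  have hu'' : u ≤ (D' - D - 1) / N + 12 * b ^ 4 + 64 * b ^ 2 := by
    exact le_of_mul_le_mul_right (hu'.trans_eq (mul_comm _ _)) hM
  have hDN : ((D' : ℝ) - D - 1) / N ≤ u / 4 := by
    rw [div_le_iff₀ hNR]; linarith
  rw [hb4, hb2] at hu''
  nlinarith

section Sum

variable [Fintype Ω]

/-- `|Ω| (log |Ω| - H(X))`, where `H(X)` is the entropy of `X` under the uniform law on `Ω`. So
`logFiberSum W - logFiberSum (W, X)` is `|Ω|` times the conditional entropy `H(X | W)`. -/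
noncomputable def logFiberSum (X : Ω → α) : ℝ := ∑ ω, Real.log (fiberCard Finset.univ X ω)

lemma logFiberSum_congr {X : Ω → α} {Y : Ω → β} (h : ∀ ω ω', X ω = X ω' ↔ Y ω = Y ω') :
    logFiberSum X = logFiberSum Y :=
  Finset.sum_congr rfl fun ω _ => by rw [fiberCard_congr h]

lemma sum_image_sum_fiber [DecidableEq γ] (W : Ω → γ) (φ : Ω → ℝ) :
    ∑ w ∈ Finset.univ.image W, ∑ ω ∈ Finset.univ.filter (fun ω => W ω = w), φ ω = ∑ ω, φ ω :=
  Finset.sum_fiberwise_of_maps_to (fun ω _ => Finset.mem_image_of_mem W (Finset.mem_univ ω)) φ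

lemma fiberCard_fiber [DecidableEq γ] (W : Ω → γ) (X : Ω → α) {w : γ} {ω : Ω} (h : W ω = w) :
    fiberCard (Finset.univ.filter fun ω => W ω = w) X ω
      = fiberCard Finset.univ (fun ω => (W ω, X ω)) ω := by
  unfold fiberCard
  congr 2
  ext ω'
  simp [h]

/-- The chain rule: entropy conditional on `W` is the average of the entropies on the fibres. -/
lemma sum_entropySum_fiber [DecidableEq γ] (W : Ω → γ) (X : Ω → α) :
    ∑ w ∈ Finset.univ.image W, entropySum (Finset.univ.filter fun ω => W ω = w) X
      = logFiberSum W - logFiberSum fun ω => (W ω, X ω) := by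
  rw [logFiberSum, logFiberSum, ← Finset.sum_sub_distrib, ← sum_image_sum_fiber W]
  refine Finset.sum_congr rfl fun w _ => Finset.sum_congr rfl fun ω hω => ?_
  have hw := (Finset.mem_filter.1 hω).2
  rw [fiberCard_fiber W X hw, Real.log_div _ (fiberCard_pos (Finset.mem_univ ω)).ne']
  · congr 2
    unfold fiberCard
    rw [hw]
    congr!
  · exact_mod_cast (Finset.card_pos.2 ⟨ω, hω⟩).ne'

lemma sum_mutualSum_fiber [DecidableEq γ] (W : Ω → γ) (X : Ω → α) (Y : Ω → β) :
    ∑ w ∈ Finset.univ.image W, mutualSum (Finset.univ.filter fun ω => W ω = w) X Y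
      = logFiberSum W + (logFiberSum fun ω => (W ω, X ω, Y ω))
        - (logFiberSum fun ω => (W ω, X ω)) - logFiberSum fun ω => (W ω, Y ω) := by
  simp only [logFiberSum]
  rw [← Finset.sum_add_distrib, ← Finset.sum_sub_distrib, ← Finset.sum_sub_distrib,
    ← sum_image_sum_fiber W]
  refine Finset.sum_congr rfl fun w _ => Finset.sum_congr rfl fun ω hω => ?_
  have hw := (Finset.mem_filter.1 hω).2
  have hS : ((Finset.univ.filter fun ω => W ω = w).card : ℝ) ≠ 0 := by
    exact_mod_cast (Finset.card_pos.2 ⟨ω, hω⟩).ne'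
  have p : ∀ {δ : Type _} (V : Ω → δ), fiberCard Finset.univ V ω ≠ 0 := fun V =>
    (fiberCard_pos (Finset.mem_univ ω)).ne'
  rw [fiberCard_fiber W _ hw, fiberCard_fiber W _ hw, fiberCard_fiber W _ hw,
    Real.log_div (mul_ne_zero (p _) hS) (mul_ne_zero (fiberCard_pos (Finset.mem_univ ω)).ne'
      (fiberCard_pos (Finset.mem_univ ω)).ne'), Real.log_mul (p _) hS,
    Real.log_mul (fiberCard_pos (Finset.mem_univ ω)).ne' (fiberCard_pos (Finset.mem_univ ω)).ne']
  have : fiberCard Finset.univ W ω = ((Finset.univ.filter fun ω => W ω = w).card : ℝ) := by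
    unfold fiberCard
    rw [hw]
    congr!
  rw [this]
  ring

/-- Submodularity of entropy. -/
lemma logFiberSum_submodular (W : Ω → γ) (X : Ω → α) (Y : Ω → β) :
    (logFiberSum fun ω => (W ω, X ω)) + (logFiberSum fun ω => (W ω, Y ω)) ≤
      logFiberSum W + logFiberSum fun ω => (W ω, X ω, Y ω) := by
  classical
  have := sum_mutualSum_fiber W X Y
  have h : 0 ≤ ∑ w ∈ Finset.univ.image W,
      mutualSum (Finset.univ.filter fun ω => W ω = w) X Y :=
    Finset.sum_nonneg fun w _ => mutualSum_nonneg _ X Y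
  linarith

end Sum

end FiniteEntropy

/-! ### Integer metrics and what is revealed by some of their distances -/

/-- The semimetrics on `V` with values in `{0, …, B}`. -/
abbrev IntMetric (V : Type*) (B : ℕ) : Type _ :=
  {d : V → V → Fin (B + 1) // (∀ i, d i i = 0) ∧ (∀ i j, d i j = d j i) ∧
    ∀ i j k, (d i j : ℕ) ≤ d i k + d k j}

/-- Only the number of integer metrics matters, so their enumeration is left to choice. -/
noncomputable instance IntMetric.instFintype {V : Type*} [Finite V] {B : ℕ} :
    Fintype (IntMetric V B) := Fintype.ofFinite _

lemma logFiberSum_comp_equiv {Ω α : Type*} [Fintype Ω] (T : Ω ≃ Ω) (X : Ω → α) :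
    logFiberSum (X ∘ T) = logFiberSum X := by
  classical
  unfold logFiberSum
  rw [← Equiv.sum_comp T fun ω => Real.log (fiberCard Finset.univ X ω)]
  refine Finset.sum_congr rfl fun ω _ => ?_
  congr 1
  unfold fiberCard
  congr 1
  refine Finset.card_bij (fun ω' _ => T ω') ?_ ?_ ?_
  · intro ω' h; simpa using h
  · intro a _ b _ h; exact T.injective h
  · intro b h; exact ⟨T.symm b, by simpa using h, by simp⟩

namespace IntMetric

variable {V : Type*} {B : ℕ}

/-- The restriction of an integer metric to a set of ordered pairs. -/
def reveal (E : Set (V × V)) (ω : IntMetric V B) (p : E) : Fin (B + 1) := ω.1 p.1.1 p.1.2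

lemma reveal_eq_iff {E : Set (V × V)} {ω ω' : IntMetric V B} :
    reveal E ω = reveal E ω' ↔ ∀ p ∈ E, ω.1 p.1 p.2 = ω'.1 p.1 p.2 := by
  simp [reveal, funext_iff]

/-- Relabelling the points of an integer metric. -/
def relabel (σ : Equiv.Perm V) : IntMetric V B ≃ IntMetric V B where
  toFun ω := ⟨fun i j => ω.1 (σ i) (σ j), fun i => ω.2.1 _, fun i j => ω.2.2.1 _ _,
    fun i j k => ω.2.2.2 _ _ _⟩
  invFun ω := ⟨fun i j => ω.1 (σ.symm i) (σ.symm j), fun i => ω.2.1 _, fun i j => ω.2.2.1 _ _,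
    fun i j k => ω.2.2.2 _ _ _⟩
  left_inv ω := by simp
  right_inv ω := by simp

/-- The set of the ordered pairs of points of `A`. -/
def square (A : Finset V) : Set (V × V) := {p | p.1 ∈ A ∧ p.2 ∈ A}

section Reveal

variable [Fintype V]

/-- With `Ω = IntMetric V B`, this is `|Ω| (log |Ω| - H)`, where `H` is the entropy of the
distances of the pairs in `E` for a uniformly random integer metric. -/
noncomputable def revealSum (B : ℕ) (E : Set (V × V)) : ℝ :=
  logFiberSum (reveal E : IntMetric V B → _)

lemma revealSum_congr {E E' : Set (V × V)}
    (h : ∀ ω ω' : IntMetric V B, (∀ p ∈ E, ω.1 p.1 p.2 = ω'.1 p.1 p.2) ↔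
      ∀ p ∈ E', ω.1 p.1 p.2 = ω'.1 p.1 p.2) : revealSum B E = revealSum B E' :=
  logFiberSum_congr fun ω ω' => by rw [reveal_eq_iff, reveal_eq_iff, h]

lemma logFiberSum_reveal_insert (E : Set (V × V)) (p : V × V) :
    (logFiberSum fun ω : IntMetric V B => (reveal E ω, ω.1 p.1 p.2))
      = revealSum B (insert p E) :=
  logFiberSum_congr fun ω ω' => by
    rw [Prod.mk.injEq, reveal_eq_iff, reveal_eq_iff, Set.forall_mem_insert, and_comm]

/-- Conditioning on more reduces entropy: `E'` reveals at least as much as `E` does. -/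
lemma revealSum_sub_le {E E' : Set (V × V)} (p : V × V)
    (h : ∀ ω ω' : IntMetric V B, (∀ p ∈ E', ω.1 p.1 p.2 = ω'.1 p.1 p.2) →
      ∀ p ∈ E, ω.1 p.1 p.2 = ω'.1 p.1 p.2) :
    revealSum B E' - revealSum B (insert p E') ≤ revealSum B E - revealSum B (insert p E) := by
  have hs := logFiberSum_submodular (reveal E : IntMetric V B → _) (reveal E')
    (fun ω => ω.1 p.1 p.2)
  rw [logFiberSum_reveal_insert] at hs
  have e1 : (logFiberSum fun ω : IntMetric V B => (reveal E ω, reveal E' ω)) = revealSum B E' :=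
    logFiberSum_congr fun ω ω' => by
      rw [Prod.mk.injEq, reveal_eq_iff, reveal_eq_iff]
      exact ⟨fun h' => h'.2, fun h' => ⟨h ω ω' h', h'⟩⟩
  have e2 : (logFiberSum fun ω : IntMetric V B => (reveal E ω, reveal E' ω, ω.1 p.1 p.2))
      = revealSum B (insert p E') :=
    logFiberSum_congr fun ω ω' => by
      rw [Prod.mk.injEq, Prod.mk.injEq, reveal_eq_iff, reveal_eq_iff, reveal_eq_iff,
        Set.forall_mem_insert]
      exact ⟨fun h' => ⟨h'.2.2, h'.2.1⟩, fun h' => ⟨h ω ω' h'.2, h'.2, h'.1⟩⟩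
  rw [e1, e2] at hs
  change _ ≤ revealSum B E + _ at hs
  linarith

lemma revealSum_sub_le_of_subset {E E' : Set (V × V)} (p : V × V) (h : E ⊆ E') :
    revealSum B E' - revealSum B (insert p E') ≤ revealSum B E - revealSum B (insert p E) :=
  revealSum_sub_le p fun _ _ h' q hq => h' q (h hq)

lemma revealSum_preimage (σ : Equiv.Perm V) (E : Set (V × V)) :
    revealSum B (Prod.map σ σ ⁻¹' E) = revealSum B E := by
  unfold revealSum
  rw [← logFiberSum_comp_equiv (relabel σ)]
  refine logFiberSum_congr fun ω ω' => ?_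
  rw [Function.comp, Function.comp, reveal_eq_iff, reveal_eq_iff]
  constructor
  · intro h p hp
    have := h (σ.symm p.1, σ.symm p.2) (by simpa using hp)
    simpa [relabel] using this
  · intro h p hp
    exact h (σ p.1, σ p.2) hp

end Reveal

/-- The lower bound `max_{a ∈ A} |d(x, a) - d(y, a)|` for `d(x, y)`. -/
def gap (A : Finset V) (x y : V) (ω : IntMetric V B) : ℕ :=
  A.sup fun a => (((ω.1 x a : ℕ) : ℤ) - (ω.1 y a : ℕ)).natAbs

lemma gap_le (A : Finset V) (x y : V) (ω : IntMetric V B) : gap A x y ω ≤ ω.1 x y := by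
  refine Finset.sup_le fun a _ => ?_
  have h1 := ω.2.2.2 x a y
  have h2 := ω.2.2.2 y a x
  rw [ω.2.2.1 y x] at h2
  omega

variable [DecidableEq V]

lemma gap_insert (A : Finset V) (x y v : V) (ω : IntMetric V B) :
    gap (insert v A) x y ω = max (gap A x y ω) (((ω.1 x v : ℕ) : ℤ) - (ω.1 y v : ℕ)).natAbs := by
  rw [gap, Finset.sup_insert, max_comm]
  rfl

lemma gap_congr {E : Set (V × V)} {A : Finset V} {x y : V}
    (hE : square (insert x A) ∪ square (insert y A) ⊆ E) {ω ω' : IntMetric V B}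
    (h : reveal E ω = reveal E ω') : gap A x y ω = gap A x y ω' := by
  rw [reveal_eq_iff] at h
  refine Finset.sup_congr rfl fun a ha => ?_
  rw [h (x, a) (hE (Or.inl ⟨by simp, by simp [ha]⟩)),
    h (y, a) (hE (Or.inr ⟨by simp, by simp [ha]⟩))]

lemma map_swap_eq {A : Finset V} {x y : V} (hx : x ∉ A) (hy : y ∉ A) :
    A.map (Equiv.swap x y).toEmbedding = A := by
  ext a
  rw [Finset.mem_map_equiv, Equiv.symm_swap, Equiv.swap_apply_def]
  split_ifs with h h'
  · subst h; simp [hx, hy]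
  · subst h'; simp [hx, hy]
  · rfl

variable [Fintype V]

/-- With `Ω = IntMetric V B`, this is `|Ω|` times the entropy of the distance of `x` and `y`
conditional on all distances within `A ∪ {x}` and within `A ∪ {y}`. -/
noncomputable def pairEntropy (B : ℕ) (A : Finset V) (x y : V) : ℝ :=
  revealSum B (square (insert x A) ∪ square (insert y A))
    - revealSum B (insert (x, y) (square (insert x A) ∪ square (insert y A)))

lemma pairEntropy_symm (A : Finset V) (x y : V) : pairEntropy B A x y = pairEntropy B A y x := by
  unfold pairEntropy
  rw [Set.union_comm]
  congr 1
  refine revealSum_congr fun ω ω' => ?_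
  rw [Set.forall_mem_insert, Set.forall_mem_insert]
  dsimp only
  rw [ω.2.2.1 x y, ω'.2.2.1 x y]

lemma pairEntropy_map (σ : Equiv.Perm V) (A : Finset V) (x y : V) :
    pairEntropy B (A.map σ.toEmbedding) (σ x) (σ y) = pairEntropy B A x y := by
  unfold pairEntropy
  rw [← revealSum_preimage σ, ← revealSum_preimage σ (insert _ _)]
  congr 2 <;> ext p <;> simp [square, Prod.ext_iff]

lemma pairEntropy_swap_right {A : Finset V} {x y v : V} (hy : y ∉ A) (hv : v ∉ A)
    (hxy : x ≠ y) (hxv : x ≠ v) : pairEntropy B A x v = pairEntropy B A x y := by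
  have := pairEntropy_map (B := B) (Equiv.swap y v) A x y
  rwa [map_swap_eq hy hv, Equiv.swap_apply_of_ne_of_ne hxy hxv, Equiv.swap_apply_left] at this

lemma pairEntropy_swap_insert {A : Finset V} {x y v : V} (hy : y ∉ A) (hv : v ∉ A)
    (hxy : x ≠ y) (hxv : x ≠ v) :
    pairEntropy B (insert y A) x v = pairEntropy B (insert v A) x y := by
  have := pairEntropy_map (B := B) (Equiv.swap y v) (insert v A) x y
  rwa [Finset.map_insert, map_swap_eq hy hv, Equiv.swap_apply_of_ne_of_ne hxy hxv,
    Equiv.swap_apply_left, Equiv.coe_toEmbedding, Equiv.swap_apply_right] at this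

/-- As `d(x, y)` lies between `gap A x y` and `2N`, its entropy is small when the gap is large. -/
lemma pairEntropy_le {N : ℕ} (hN : 0 < N) (A : Finset V) (x y : V) :
    pairEntropy (2 * N) A x y ≤ ∑ ω : IntMetric V (2 * N),
      (Real.log N + (1 + 1 / N - (gap A x y ω : ℝ) / N)) := by
  classical
  have hNR : (0 : ℝ) < N := by exact_mod_cast hN
  set E := square (insert x A) ∪ square (insert y A) with hE
  have hsum := sum_entropySum_fiber (reveal E : IntMetric V (2 * N) → _)
    (fun ω => ((ω.1 x y : Fin (2 * N + 1)) : ℕ))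
  have e : (logFiberSum fun ω : IntMetric V (2 * N) =>
      (reveal E ω, ((ω.1 x y : Fin (2 * N + 1)) : ℕ))) = revealSum (2 * N) (insert (x, y) E) := by
    rw [← logFiberSum_reveal_insert]
    exact logFiberSum_congr fun ω ω' => by simp [Fin.ext_iff]
  rw [e] at hsum
  change _ = pairEntropy (2 * N) A x y at hsum
  rw [← hsum, ← sum_image_sum_fiber (reveal E : IntMetric V (2 * N) → _)]
  refine Finset.sum_le_sum fun w hw => ?_
  obtain ⟨ω₀, -, rfl⟩ := Finset.mem_image.1 hw
  have hg : ∀ ω ∈ Finset.univ.filter (fun ω : IntMetric V (2 * N) => reveal E ω = reveal E ω₀),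
      gap A x y ω = gap A x y ω₀ :=
    fun ω hω => gap_congr subset_rfl (Finset.mem_filter.1 hω).2
  rw [Finset.sum_congr rfl fun ω hω => by rw [hg ω hω], Finset.sum_const, nsmul_eq_mul]
  refine (entropySum_le (K := Finset.Icc (gap A x y ω₀) (2 * N)) (fun ω hω => ?_) hNR).trans ?_
  · rw [Finset.mem_Icc, ← hg ω hω]
    exact ⟨gap_le _ _ _ _, by have := (ω.1 x y).2; omega⟩
  · have h1 : gap A x y ω₀ ≤ 2 * N := by
      have := (ω₀.1 x y).2
      have := gap_le A x y ω₀
      omega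
    rw [Nat.card_Icc, Nat.cast_sub (by omega)]
    push_cast
    refine mul_le_mul_of_nonneg_left (le_of_eq ?_) (by positivity)
    field_simp
    ring

/-! ### Decay of the conditional entropy of a distance -/

/-- Effect of one more base point `v` on the gap of `x` and `y`. The distances `d(x, v)` and
`d(y, v)`, conditional on the distances within `A ∪ {x}`, `A ∪ {y}` and `A ∪ {v}`, have entropies
at least `pairEntropy (A ∪ {v})`, and their conditional mutual information is at most the drop of
`pairEntropy` from `A` to `A ∪ {v}`. -/
lemma tangent_sub_le_gap {N : ℕ} (hN : 0 < N) {A : Finset V} {x y v : V} (hx : x ∉ A)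
    (hy : y ∉ A) (hv : v ∉ A) (hxy : x ≠ y) (hxv : x ≠ v) (hyv : y ≠ v) {t : ℝ} (ht : 0 ≤ t) :
    (3 * t ^ 2 * (∑ ω : IntMetric V (2 * N), (1 - Real.log N - ((gap A x y ω : ℝ) + 1) / N)
        + pairEntropy (2 * N) (insert v A) x y)
        - 2 * t ^ 3 * Fintype.card (IntMetric V (2 * N))) / 2 ^ 17
      - (pairEntropy (2 * N) A x y - pairEntropy (2 * N) (insert v A) x y) ≤
    ∑ ω : IntMetric V (2 * N), ((gap (insert v A) x y ω : ℝ) - gap A x y ω) / N := by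
  classical
  set E := square (insert x A) ∪ square (insert y A) ∪ square (insert v A) with hE
  set Y₁ : IntMetric V (2 * N) → ℕ := fun ω => ω.1 x v with hY₁
  set Y₂ : IntMetric V (2 * N) → ℕ := fun ω => ω.1 y v with hY₂
  set W : IntMetric V (2 * N) → _ := reveal E with hW
  have e1 : (logFiberSum fun ω => (W ω, Y₁ ω)) = revealSum (2 * N) (insert (x, v) E) := by
    rw [← logFiberSum_reveal_insert]
    exact logFiberSum_congr fun ω ω' => by simp [Fin.ext_iff, hW, hY₁]
  have e2 : (logFiberSum fun ω => (W ω, Y₂ ω)) = revealSum (2 * N) (insert (y, v) E) := by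
    rw [← logFiberSum_reveal_insert]
    exact logFiberSum_congr fun ω ω' => by simp [Fin.ext_iff, hW, hY₂]
  have e3 : (logFiberSum fun ω => (W ω, Y₁ ω, Y₂ ω))
      = revealSum (2 * N) (insert (x, v) (insert (y, v) E)) := by
    refine logFiberSum_congr fun ω ω' => ?_
    rw [reveal_eq_iff, Set.forall_mem_insert, Set.forall_mem_insert, ← reveal_eq_iff]
    simp only [hW, hY₁, hY₂, Prod.mk.injEq, Fin.ext_iff]
    tauto
  have e0 : logFiberSum W = revealSum (2 * N) E := rfl
  have hS1 := sum_entropySum_fiber W Y₁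
  have hS2 := sum_entropySum_fiber W Y₂
  have hI := sum_mutualSum_fiber W Y₁ Y₂
  rw [e0, e1] at hS1
  rw [e0, e2] at hS2
  rw [e0, e1, e2, e3] at hI
  have sub : ∀ {a b : Finset V}, a ⊆ b → square a ⊆ square b :=
    fun h p hp => ⟨h hp.1, h hp.2⟩
  have b1 : pairEntropy (2 * N) (insert v A) x y
      ≤ revealSum (2 * N) E - revealSum (2 * N) (insert (x, v) E) := by
    rw [← pairEntropy_swap_insert hy hv hxy hxv]
    refine revealSum_sub_le_of_subset _ (Set.union_subset (Set.union_subset ?_ ?_) ?_)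
    · exact (sub (Finset.insert_subset_insert _ (Finset.subset_insert _ _))).trans
        Set.subset_union_left
    · exact (sub (Finset.subset_insert _ _)).trans Set.subset_union_left
    · exact (sub (Finset.insert_subset_insert _ (Finset.subset_insert _ _))).trans
        Set.subset_union_right
  have b2 : pairEntropy (2 * N) (insert v A) x y
      ≤ revealSum (2 * N) E - revealSum (2 * N) (insert (y, v) E) := by
    rw [pairEntropy_symm, ← pairEntropy_swap_insert hx hv hxy.symm hyv]
    refine revealSum_sub_le_of_subset _ (Set.union_subset (Set.union_subset ?_ ?_) ?_)
    · exact (sub (Finset.subset_insert _ _)).trans Set.subset_union_left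
    · exact (sub (Finset.insert_subset_insert _ (Finset.subset_insert _ _))).trans
        Set.subset_union_left
    · exact (sub (Finset.insert_subset_insert _ (Finset.subset_insert _ _))).trans
        Set.subset_union_right
  have b3 : revealSum (2 * N) E - revealSum (2 * N) (insert (x, v) E)
      ≤ pairEntropy (2 * N) A x y := by
    rw [← pairEntropy_swap_right hy hv hxy hxv]
    refine revealSum_sub_le_of_subset _ (Set.union_subset ?_ ?_)
    · exact Set.subset_union_left.trans Set.subset_union_left
    · exact Set.subset_union_right
  have b4 : pairEntropy (2 * N) (insert v A) x y ≤ revealSum (2 * N) (insert (y, v) E)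
      - revealSum (2 * N) (insert (x, v) (insert (y, v) E)) := by
    rw [← pairEntropy_swap_insert hy hv hxy hxv]
    refine revealSum_sub_le_of_subset _ (Set.insert_subset ?_
      (Set.union_subset (Set.union_subset ?_ ?_) ?_))
    · exact Or.inr ⟨by simp, by simp⟩
    · exact (sub (Finset.insert_subset_insert _ (Finset.subset_insert _ _))).trans
        Set.subset_union_left
    · exact (sub (Finset.subset_insert _ _)).trans Set.subset_union_left
    · exact (sub (Finset.insert_subset_insert _ (Finset.subset_insert _ _))).trans
        Set.subset_union_right
  have hfib := Finset.sum_le_sum (s := Finset.univ.image W) (f := fun w =>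
      (3 * t ^ 2 * (∑ ω ∈ Finset.univ.filter (fun ω => W ω = w),
          (1 - Real.log N - ((gap A x y ω : ℝ) + 1) / N)
        + (entropySum (Finset.univ.filter fun ω => W ω = w) Y₁
          + entropySum (Finset.univ.filter fun ω => W ω = w) Y₂) / 2)
        - 2 * t ^ 3 * ∑ ω ∈ Finset.univ.filter (fun ω => W ω = w), 1) / 2 ^ 17
      - mutualSum (Finset.univ.filter fun ω => W ω = w) Y₁ Y₂)
    (g := fun w => ∑ ω ∈ Finset.univ.filter (fun ω => W ω = w),
      ((gap (insert v A) x y ω : ℝ) - gap A x y ω) / N) (fun w hw => by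
    obtain ⟨ω₀, -, rfl⟩ := Finset.mem_image.1 hw
    have hg : ∀ ω ∈ Finset.univ.filter (fun ω => W ω = W ω₀), gap A x y ω = gap A x y ω₀ :=
      fun ω hω => gap_congr Set.subset_union_left (Finset.mem_filter.1 hω).2
    have hmain := tangent_sub_mutualSum_le (S := Finset.univ.filter fun ω => W ω = W ω₀)
      ⟨ω₀, by simp⟩ hN (Y₁ := Y₁) (Y₂ := Y₂)
      (fun ω _ => Nat.lt_succ_iff.1 (ω.1 x v).2) (fun ω _ => Nat.lt_succ_iff.1 (ω.1 y v).2)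
      (gap A x y ω₀) ht
    rw [Finset.sum_congr rfl fun ω hω => by rw [hg ω hω], Finset.sum_const, Finset.sum_const,
      nsmul_eq_mul, nsmul_eq_mul, mul_one]
    refine hmain.trans (le_of_eq (Finset.sum_congr rfl fun ω hω => ?_))
    rw [gap_insert, hg ω hω])
  rw [sum_image_sum_fiber, Finset.sum_sub_distrib, ← Finset.sum_div, Finset.sum_sub_distrib,
    ← Finset.mul_sum, ← Finset.mul_sum, Finset.sum_add_distrib, sum_image_sum_fiber,
    sum_image_sum_fiber, ← Finset.sum_div, Finset.sum_add_distrib, hS1, hS2, hI] at hfib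
  have hc : ∑ _ω : IntMetric V (2 * N), (1 : ℝ) = Fintype.card (IntMetric V (2 * N)) := by simp
  rw [hc] at hfib
  refine le_trans ?_ hfib
  have ht2 : 0 ≤ t ^ 2 := by positivity
  have := mul_le_mul_of_nonneg_left (add_le_add b1 b2) ht2
  linarith

end IntMetric

lemma mul_sq_le_one_of_le_sub_cube {c k v v' : ℝ} (hc : 0 ≤ c) (hk : 0 ≤ k) (hv : 0 < v)
    (hv' : 0 ≤ v') (h : v' ≤ v - c * v ^ 3) (hkv : 2 * c * k * v ^ 2 ≤ 1) (hcv : 2 * c * v ^ 2 ≤ 1) :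
    2 * c * (k + 1) * v' ^ 2 ≤ 1 := by
  set z := c * v ^ 2 with hz
  have hz0 : 0 ≤ z := by positivity
  have h1 : v' ≤ v * (1 - z) := by rw [hz]; linarith
  have h2 : v' ^ 2 ≤ (v * (1 - z)) ^ 2 := pow_le_pow_left₀ hv' h1 2
  calc 2 * c * (k + 1) * v' ^ 2 ≤ 2 * c * (k + 1) * (v * (1 - z)) ^ 2 := by gcongr
    _ = (2 * c * k * v ^ 2 + 2 * z) * (1 - z) ^ 2 := by rw [hz]; ring
    _ ≤ (1 + 2 * z) * (1 - z) ^ 2 := by gcongr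
    _ ≤ 1 := by nlinarith [sq_nonneg z]

namespace IntMetric

variable {V : Type*} [Fintype V]

lemma card_pos (B : ℕ) : 0 < Fintype.card (IntMetric V B) :=
  Fintype.card_pos_iff.2 ⟨⟨fun _ _ => 0, by simp⟩⟩

variable [DecidableEq V]

/-- The entropy of the distance of two points, conditional on their distances to `|A|` other
points (and on all distances within `A`), exceeds `log N` by at most `O(|A|^{-1/2})`. The sum of
this excess and of an upper bound for it in terms of the expected gap decreases by a multiple of
its cube when a point is added to `A`. -/
theorem pairEntropy_le_sqrt {N : ℕ} (hN : 0 < N) (A : Finset V) :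
    ∀ x y : V, x ∉ A → y ∉ A → x ≠ y →
    pairEntropy (2 * N) A x y ≤ Fintype.card (IntMetric V (2 * N)) *
      (Real.log N + max ((2 : ℝ) / N) (1024 / √(A.card + 1))) := by
  have hNR : (0 : ℝ) < N := by exact_mod_cast hN
  have hN1 : (1 : ℝ) ≤ N := by exact_mod_cast hN
  set M : ℝ := (Fintype.card (IntMetric V (2 * N)) : ℝ) with hM
  have hM0 : 0 < M := by rw [hM]; exact_mod_cast IntMetric.card_pos _
  set η : Finset V → V → V → ℝ := fun A x y => pairEntropy (2 * N) A x y / M - Real.log N with hη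
  set u : Finset V → V → V → ℝ := fun A x y =>
    1 + 1 / N - (∑ ω : IntMetric V (2 * N), (gap A x y ω : ℝ)) / (N * M) with hu
  have eη : ∀ A x y, pairEntropy (2 * N) A x y = M * (η A x y + Real.log N) := by
    intro A x y; simp only [hη]; field_simp; ring
  have eu : ∀ A x y, ∑ ω : IntMetric V (2 * N), (gap A x y ω : ℝ)
      = N * M * (1 + 1 / N - u A x y) := by
    intro A x y; simp only [hu]; field_simp; ring
  have hηu : ∀ A x y, η A x y ≤ u A x y := by
    intro A x y
    have h := pairEntropy_le hN A x y
    rw [Finset.sum_add_distrib, Finset.sum_sub_distrib, ← Finset.sum_div, eu, eη] at h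
    simp only [Finset.sum_const, Finset.card_univ, nsmul_eq_mul, ← hM] at h
    have e : (N : ℝ) * M * (1 + 1 / N - u A x y) / N = M * (1 + 1 / N - u A x y) := by field_simp
    rw [e] at h
    refine le_of_mul_le_mul_left ?_ hM0
    linarith
  have hu2 : ∀ A x y, u A x y ≤ 2 := by
    intro A x y
    have h1 : (0 : ℝ) ≤ (∑ ω : IntMetric V (2 * N), (gap A x y ω : ℝ)) / (N * M) := by positivity
    have h2 : 1 / (N : ℝ) ≤ 1 := by rw [div_le_one hNR]; exact hN1
    simp only [hu]; linarith
  have hanti : ∀ {A : Finset V} {x y v : V}, η (insert v A) x y ≤ η A x y := by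
    intro A x y v
    simp only [hη]
    gcongr
    refine revealSum_sub_le_of_subset _ (Set.union_subset_union ?_ ?_) <;>
    exact fun p hp => ⟨Finset.insert_subset_insert _ (Finset.subset_insert _ _) hp.1,
      Finset.insert_subset_insert _ (Finset.subset_insert _ _) hp.2⟩
  have hstep : ∀ {A : Finset V} {x y v : V}, x ∉ A → y ∉ A → v ∉ A → x ≠ y → x ≠ v → y ≠ v →
      2 / N ≤ η (insert v A) x y →
      u (insert v A) x y + η (insert v A) x y ≤ u A x y + η A x y - u A x y ^ 3 / 2 ^ 17 := by
    intro A x y v hx hy hv hxy hxv hyv h2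
    have hu0 : 0 ≤ u A x y := (div_nonneg zero_le_two hNR.le).trans
      (h2.trans (hanti.trans (hηu A x y)))
    have h := tangent_sub_le_gap hN hx hy hv hxy hxv hyv hu0
    rw [← Finset.sum_div, Finset.sum_sub_distrib, ← Finset.sum_div, Finset.sum_sub_distrib,
      Finset.sum_add_distrib, eu, Finset.sum_sub_distrib, eu, eu, eη, eη] at h
    simp only [Finset.sum_const, Finset.card_univ, nsmul_eq_mul, ← hM, mul_one] at h
    generalize u A x y = U at *
    generalize η A x y = H at *
    generalize u (insert v A) x y = U' at *
    generalize η (insert v A) x y = H' at *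
    have e1 : M - M * Real.log N - (N * M * (1 + 1 / N - U) + M) / N
        + M * (H' + Real.log N) = M * (U + (H' - 2 / N)) := by field_simp; ring
    have e2 : ((N : ℝ) * M * (1 + 1 / N - U') - N * M * (1 + 1 / N - U)) / N = M * (U - U') := by
      field_simp; ring
    rw [e1, e2] at h
    have h3 : 0 ≤ U ^ 2 * (M * (H' - 2 / N)) := by
      have : 0 ≤ H' - 2 / N := by linarith
      positivity
    refine le_of_mul_le_mul_left ?_ hM0
    linarith
  clear_value u η
  clear_value M
  have hrec : ∀ (A : Finset V) (x y : V), x ∉ A → y ∉ A → x ≠ y → 2 / N ≤ η A x y →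
      2 * (1 / 2 ^ 20) * ((A.card : ℝ) + 1) * (u A x y + η A x y) ^ 2 ≤ 1 := by
    intro A
    have hbd : ∀ {A : Finset V} {x y : V}, 2 / N ≤ η A x y →
        0 < u A x y + η A x y ∧ u A x y + η A x y ≤ 4 := by
      intro A x y h
      have h0 : (0 : ℝ) < 2 / N := by positivity
      have h1 := hηu A x y
      have h2 := hu2 A x y
      constructor <;> linarith
    induction A using Finset.induction_on with
    | empty =>
      intro x y _ _ _ h
      obtain ⟨h1, h2⟩ := hbd h
      rw [Finset.card_empty]
      push_cast
      nlinarith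
    | insert v A hv ih =>
      intro x y hx hy hxy h
      rw [Finset.mem_insert, not_or] at hx hy
      obtain ⟨h1, h2⟩ := hbd h
      have h' := h.trans (hanti (x := x) (y := y))
      obtain ⟨h3, h4⟩ := hbd h'
      have h5 := hstep hx.2 hy.2 hv hxy hx.1 hy.1 h
      rw [Finset.card_insert_of_notMem hv]
      push_cast
      have hcube : (u A x y + η A x y) ^ 3 ≤ (2 * u A x y) ^ 3 :=
        pow_le_pow_left₀ h3.le (by linarith [hηu A x y]) 3
      refine mul_sq_le_one_of_le_sub_cube (by norm_num)
        (Nat.cast_add_one_pos A.card).le h3 h1.le ?_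
        (ih x y hx.2 hy.2 hxy h') ?_
      · refine h5.trans ?_
        rw [mul_pow] at hcube
        linarith
      · nlinarith
  intro x y hx hy hxy
  rw [eη, add_comm]
  refine mul_le_mul_of_nonneg_left (add_le_add_right ?_ _) hM0.le
  rcases le_total (η A x y) (2 / N) with h | h
  · exact h.trans (le_max_left _ _)
  · refine le_trans ?_ (le_max_right _ _)
    have h0 : (0 : ℝ) ≤ 2 / N := by positivity
    have h1 := hrec A x y hx hy hxy h
    have h2 := hηu A x y
    have hA := Nat.cast_add_one_pos (α := ℝ) A.card
    rw [le_div_iff₀ (Real.sqrt_pos.2 hA)]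
    refine abs_le_of_sq_le_sq' ?_ (by norm_num) |>.2
    rw [mul_pow, Real.sq_sqrt hA.le]
    have h3 : η A x y ^ 2 ≤ (u A x y + η A x y) ^ 2 :=
      pow_le_pow_left₀ (h0.trans h) (by linarith) 2
    have h4 := mul_le_mul_of_nonneg_right h3 hA.le
    linarith

/-! ### The number of integer metrics -/

lemma sum_inv_sqrt_le (n : ℕ) : ∑ i ∈ Finset.range n, 1 / √((i : ℝ) + 1) ≤ 2 * √n := by
  induction n with
  | zero => simp
  | succ n ih =>
    rw [Finset.sum_range_succ]
    push_cast
    have h1 : √(n : ℝ) ≤ √((n : ℝ) + 1) := Real.sqrt_le_sqrt (by linarith)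
    have h2 := Real.sq_sqrt (show (0 : ℝ) ≤ n by positivity)
    have h3 := Real.sq_sqrt (show (0 : ℝ) ≤ (n : ℝ) + 1 by positivity)
    have h0 := Real.sqrt_nonneg (n : ℝ)
    have h4 : 0 < √((n : ℝ) + 1) := by positivity
    have : 1 / √((n : ℝ) + 1) ≤ 2 * √((n : ℝ) + 1) - 2 * √n := by
      rw [div_le_iff₀ h4]; nlinarith
    linarith

/-- Revealing the distances in lexicographic order: when that of `i < j` is revealed, all
distances to the points before `i` are known. -/
theorem log_card_le {n : ℕ} (hn : 0 < n) :
    Real.log (Fintype.card (IntMetric (Fin n) (2 * n))) ≤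
      n.choose 2 * Real.log n + 2048 * (n * √n) := by
  classical
  have hnR : (0 : ℝ) < n := by exact_mod_cast hn
  set M : ℝ := (Fintype.card (IntMetric (Fin n) (2 * n)) : ℝ) with hM
  have hM0 : 0 < M := by rw [hM]; exact_mod_cast IntMetric.card_pos _
  set E : ℕ → Set (Fin n × Fin n) := fun i => {p | (p.1 : ℕ) < i ∨ (p.2 : ℕ) < i} with hE
  have h0 : revealSum (2 * n) (E 0) = M * Real.log M := by
    have : ∀ ω : IntMetric (Fin n) (2 * n), fiberCard Finset.univ (reveal (E 0)) ω = M := by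
      intro ω
      rw [fiberCard_eq_card fun ω' _ => ?_, Finset.card_univ]
      rw [reveal_eq_iff]
      simp [hE]
    rw [revealSum, logFiberSum, Finset.sum_congr rfl fun ω _ => by rw [this ω]]
    simp [hM]
  have hn0 : revealSum (2 * n) (E n) = 0 := by
    have : ∀ ω : IntMetric (Fin n) (2 * n), fiberCard Finset.univ (reveal (E n)) ω = 1 := by
      intro ω
      refine fiberCard_eq_one (Finset.mem_univ ω) fun ω' _ h => ?_
      rw [reveal_eq_iff] at h
      ext i j
      rw [h (i, j) (Or.inl i.2)]
    rw [revealSum, logFiberSum, Finset.sum_congr rfl fun ω _ => by rw [this ω]]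
    simp
  set b : ℕ → ℝ := fun i => Real.log n + 1024 / √((i : ℝ) + 1) with hb
  have hstage : ∀ i ∈ Finset.range n, revealSum (2 * n) (E i) - revealSum (2 * n) (E (i + 1)) ≤
      M * (((n - 1 - i : ℕ) : ℝ) * b i) := by
    intro i hi
    have hin := Finset.mem_range.1 hi
    set k : Fin n := ⟨i, hin⟩ with hk
    have hset : ∀ S : Finset (Fin n), S ⊆ Finset.Ioi k →
        revealSum (2 * n) (E i) - revealSum (2 * n) (E i ∪ {p | p.1 = k ∧ p.2 ∈ S}) ≤
          S.card * (M * b i) := by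
      intro S
      induction S using Finset.induction_on with
      | empty => intro _; simp
      | insert j S hj ih =>
        intro hS
        have hkj : k < j := Finset.mem_Ioi.1 (hS (Finset.mem_insert_self _ _))
        have h1 := ih ((Finset.subset_insert _ _).trans hS)
        have e : E i ∪ {p | p.1 = k ∧ p.2 ∈ insert j S}
            = insert (k, j) (E i ∪ {p | p.1 = k ∧ p.2 ∈ S}) := by
          ext p
          simp only [Set.mem_union, Set.mem_ofPred_eq, Finset.mem_insert, Set.mem_insert_iff,
            Prod.ext_iff]
          tauto
        have h2 : revealSum (2 * n) (E i ∪ {p | p.1 = k ∧ p.2 ∈ S})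
            - revealSum (2 * n) (insert (k, j) (E i ∪ {p | p.1 = k ∧ p.2 ∈ S}))
            ≤ pairEntropy (2 * n) (Finset.Iio k) k j := by
          refine revealSum_sub_le _ fun ω ω' h p hp => ?_
          have hlt : ∀ a : Fin n, a ∈ Finset.Iio k → (a : ℕ) < i := fun a ha => by
            have := Finset.mem_Iio.1 ha
            rwa [Fin.lt_def] at this
          have hcase : p ∈ E i ∨ p.1 = p.2 := by
            rcases hp with ⟨h1, h2⟩ | ⟨h1, h2⟩ <;> rw [Finset.mem_insert] at h1 h2 <;>
            rcases h1 with h1 | h1 <;> rcases h2 with h2 | h2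
            all_goals first
              | exact Or.inr (h1.trans h2.symm)
              | exact Or.inl (Or.inl (hlt _ h1))
              | exact Or.inl (Or.inr (hlt _ h2))
          rcases hcase with h3 | h3
          · exact h p (Or.inl h3)
          · rw [h3, ω.2.1, ω'.2.1]
        have h3 := pairEntropy_le_sqrt hn (Finset.Iio k) k j (by simp)
          (by simpa using hkj.le) hkj.ne
        have h4 : max (2 / (n : ℝ)) (1024 / √(((Finset.Iio k).card : ℝ) + 1))
            ≤ 1024 / √((i : ℝ) + 1) := by
          have hcard : (Finset.Iio k).card = i := by simp [hk]
          rw [hcard]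
          refine max_le ?_ le_rfl
          have : √((i : ℝ) + 1) ≤ n := by
            have h5 : (i : ℝ) + 1 ≤ n := by exact_mod_cast hin
            rw [Real.sqrt_le_left (by positivity)]
            have : (1 : ℝ) ≤ n := by exact_mod_cast hn
            nlinarith
          rw [div_le_div_iff₀ hnR (by positivity)]
          linarith
        rw [e, Finset.card_insert_of_notMem hj]
        push_cast
        have h5 := mul_le_mul_of_nonneg_left (add_le_add_right h4 (Real.log n)) hM0.le
        simp only [hb] at h1 ⊢
        linarith
    have hfull := hset (Finset.Ioi k) subset_rfl
    have e : revealSum (2 * n) (E i ∪ {p | p.1 = k ∧ p.2 ∈ Finset.Ioi k})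
        = revealSum (2 * n) (E (i + 1)) := by
      refine revealSum_congr fun ω ω' => ⟨fun h => ?_, fun h => ?_⟩
      · have hrow : ∀ c : Fin n, ω.1 k c = ω'.1 k c := by
          intro c
          rcases lt_trichotomy c k with hc | hc | hc
          · exact h (k, c) (Or.inl (Or.inr hc))
          · rw [hc, ω.2.1, ω'.2.1]
          · exact h (k, c) (Or.inr ⟨rfl, Finset.mem_Ioi.2 hc⟩)
        intro p hp
        by_cases hpi : p ∈ E i
        · exact h p (Or.inl hpi)
        · simp only [hE, Set.mem_ofPred_eq, not_or, not_lt] at hp hpi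
          rcases hp with hp | hp
          · have : p.1 = k := Fin.ext (by simp only [hk]; omega)
            rw [this]; exact hrow _
          · have : p.2 = k := Fin.ext (by simp only [hk]; omega)
            rw [this, ω.2.2.1, ω'.2.2.1]; exact hrow _
      · rintro p (hp | ⟨hp, -⟩)
        · refine h p ?_
          simp only [hE, Set.mem_ofPred_eq] at hp ⊢
          omega
        · refine h p (Or.inl ?_)
          rw [hp]
          exact Nat.lt_succ_self i
    rw [e, Fin.card_Ioi] at hfull
    simp only [hk] at hfull
    linarith
  have hsum := Finset.sum_le_sum hstage
  rw [Finset.sum_range_sub', h0, hn0, sub_zero, ← Finset.mul_sum] at hsum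
  refine (le_of_mul_le_mul_left hsum hM0).trans ?_
  have hch : ∑ i ∈ Finset.range n, ((n - 1 - i : ℕ) : ℝ) = n.choose 2 := by
    rw [Finset.sum_range_reflect (fun j => (j : ℝ)), ← Nat.cast_sum, Finset.sum_range_id,
      Nat.choose_two_right]
  calc ∑ i ∈ Finset.range n, ((n - 1 - i : ℕ) : ℝ) * b i
      ≤ ∑ i ∈ Finset.range n, (((n - 1 - i : ℕ) : ℝ) * Real.log n
        + n * 1024 * (1 / √((i : ℝ) + 1))) := by
        refine Finset.sum_le_sum fun i _ => ?_
        simp only [hb]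
        rw [mul_add]
        refine add_le_add_right ?_ _
        rw [mul_assoc, mul_one_div]
        have : ((n - 1 - i : ℕ) : ℝ) ≤ n := by
          exact_mod_cast (Nat.sub_le _ _).trans (Nat.sub_le _ _)
        gcongr
    _ = n.choose 2 * Real.log n + n * 1024 * ∑ i ∈ Finset.range n, 1 / √((i : ℝ) + 1) := by
        rw [Finset.sum_add_distrib, ← Finset.sum_mul, hch, Finset.mul_sum]
    _ ≤ n.choose 2 * Real.log n + n * 1024 * (2 * √n) := by
        gcongr
        exact sum_inv_sqrt_le n
    _ = n.choose 2 * Real.log n + 2048 * (n * √n) := by ring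

end IntMetric

/-! ### The upper bound for the volume -/

open IntMetric in
/-- The metric polytope is covered by the boxes of side `1 / N` at the integer metrics. -/
lemma volume_metricPolytope_le_card {n N : ℕ} (hN : 0 < N) :
    volume (metricPolytope n) ≤ Fintype.card (IntMetric (Fin n) (2 * N)) *
      ENNReal.ofReal (((N : ℝ)⁻¹) ^ (n.choose 2)) := by
  classical
  have hNR : (0 : ℝ) < N := by exact_mod_cast hN
  set box : IntMetric (Fin n) (2 * N) → Set (PointPair n → ℝ) := fun ω =>
    {d | ∀ (i j : Fin n) (h : i ≠ j), d (pointPair h) ∈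
      Set.Ioc (((ω.1 i j : ℕ) : ℝ) / N - 1 / N) (((ω.1 i j : ℕ) : ℝ) / N)} with hbox
  have hvol : ∀ ω, volume (box ω) ≤ ENNReal.ofReal (((N : ℝ)⁻¹) ^ (n.choose 2)) := by
    intro ω
    set f : PointPair n → ℕ := fun e => Sym2.lift ⟨fun i j => (ω.1 i j : ℕ), fun i j => by
      dsimp only
      rw [ω.2.2.1 i j]⟩ e.1 with hf
    have hsub : box ω ⊆ Set.univ.pi fun e => Set.Ioc ((f e : ℝ) / N - 1 / N) ((f e : ℝ) / N) := by
      rintro d hd ⟨e, he⟩ -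
      induction e using Sym2.ind with
      | _ i j => exact hd i j fun h => he (Sym2.mk_isDiag_iff.2 h)
    refine (measure_mono hsub).trans (le_of_eq ?_)
    rw [volume_pi_pi]
    have hcard : Fintype.card (PointPair n) = n.choose 2 := by
      rw [Sym2.card_subtype_not_diag, Fintype.card_fin]
    simp only [Real.volume_Ioc, sub_sub_cancel, Finset.prod_const, Finset.card_univ, hcard]
    rw [← ENNReal.ofReal_pow (by positivity), one_div]
  have hcov : metricPolytope n ⊆ ⋃ ω ∈ (Finset.univ : Finset (IntMetric (Fin n) (2 * N))),
      box ω := by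
    rintro d ⟨⟨hpos, htri⟩, hle⟩
    set D : Fin n → Fin n → ℝ := fun i j => if h : i = j then 0 else d (pointPair h) with hD
    have hD0 : ∀ i, D i i = 0 := fun i => by simp [hD]
    have hDs : ∀ i j, D i j = D j i := by
      intro i j
      simp only [hD]
      by_cases h : i = j
      · subst h; rfl
      · rw [dif_neg h, dif_neg (Ne.symm h)]
        congr 1
        exact Subtype.ext Sym2.eq_swap
    have hDn : ∀ i j, 0 ≤ D i j := by
      intro i j
      simp only [hD]
      split_ifs with h
      · exact le_rfl
      · exact (hpos _).le
    have hD2 : ∀ i j, D i j ≤ 2 := by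
      intro i j
      simp only [hD]
      split_ifs with h
      · norm_num
      · exact hle _
    have hDt : ∀ i j k, D i j ≤ D i k + D k j := by
      intro i j k
      by_cases hij : i = j
      · rw [hij, hD0]; exact add_nonneg (hDn _ _) (hDn _ _)
      by_cases hik : i = k
      · rw [hik, hD0]; linarith
      by_cases hkj : k = j
      · rw [hkj, hD0]; linarith
      simp only [hD, dif_neg hij, dif_neg hik, dif_neg hkj]
      exact htri i j k hij hik hkj
    have hceil : ∀ i j, ⌈N * D i j⌉₊ < 2 * N + 1 := by
      intro i j
      rw [Nat.lt_succ_iff, Nat.ceil_le]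
      push_cast
      nlinarith [hD2 i j]
    refine Set.mem_iUnion₂.2 ⟨⟨fun i j => ⟨⌈N * D i j⌉₊, hceil i j⟩, fun i => ?_, fun i j => ?_,
      fun i j k => ?_⟩, Finset.mem_univ _, fun i j h => ?_⟩
    · simp [hD0]
    · simp only [hDs i j]
    · dsimp only
      rw [Nat.ceil_le]
      push_cast
      have h1 := Nat.le_ceil (N * D i k)
      have h2 := Nat.le_ceil (N * D k j)
      nlinarith [hDt i j k]
    · have e : d (pointPair h) = D i j := by simp only [hD, dif_neg h]
      rw [e]
      have h1 := Nat.le_ceil (N * D i j)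
      have h2 := Nat.ceil_lt_add_one (mul_nonneg hNR.le (hDn i j))
      constructor
      · rw [← sub_div, div_lt_iff₀ hNR]
        dsimp only
        linarith
      · rw [le_div_iff₀ hNR]
        dsimp only
        linarith
  calc volume (metricPolytope n) ≤ volume (⋃ ω ∈ Finset.univ, box ω) := measure_mono hcov
    _ ≤ ∑ ω ∈ Finset.univ, volume (box ω) := measure_biUnion_finset_le _ _
    _ ≤ ∑ ω ∈ (Finset.univ : Finset (IntMetric (Fin n) (2 * N))),
        ENNReal.ofReal (((N : ℝ)⁻¹) ^ (n.choose 2)) := Finset.sum_le_sum fun ω _ => hvol ω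
    _ = _ := by rw [Finset.sum_const, Finset.card_univ, nsmul_eq_mul]

theorem volume_metricPolytope_le {n : ℕ} (hn : 0 < n) :
    volume (metricPolytope n) ≤ ENNReal.ofReal (Real.exp (2048 * (n : ℝ) ^ (3 / 2 : ℝ))) := by
  have hnR : (0 : ℝ) < n := by exact_mod_cast hn
  refine (volume_metricPolytope_le_card (N := n) hn).trans ?_
  rw [← ENNReal.ofReal_natCast, ← ENNReal.ofReal_mul (by positivity)]
  refine ENNReal.ofReal_le_ofReal ?_
  have hpow : (n : ℝ) ^ (3 / 2 : ℝ) = n * √n := by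
    rw [Real.sqrt_eq_rpow, show (3 / 2 : ℝ) = 1 + 1 / 2 by norm_num, Real.rpow_add hnR,
      Real.rpow_one]
  have hcard : (0 : ℝ) < Fintype.card (IntMetric (Fin n) (2 * n)) := by
    exact_mod_cast IntMetric.card_pos _
  rw [← Real.log_le_iff_le_exp (by positivity), Real.log_mul hcard.ne' (by positivity),
    Real.log_pow, Real.log_inv, hpow]
  linarith [IntMetric.log_card_le hn]

/-! ### The local lemma -/

section LocalLemma

variable {Ω ι : Type*}

/-- The event that none of the events `A j`, `j ∈ S`, occurs. -/
def avoid (A : ι → Set Ω) (S : Finset ι) : Set Ω := {ω | ∀ j ∈ S, ω ∉ A j}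

variable {A : ι → Set Ω}

lemma avoid_anti {S T : Finset ι} (h : S ⊆ T) : avoid A T ⊆ avoid A S :=
  fun _ hω j hj => hω j (h hj)

variable [DecidableEq ι]

lemma avoid_insert (j : ι) (S : Finset ι) : avoid A (insert j S) = avoid A S \ A j := by
  ext ω
  simp only [avoid, Set.mem_ofPred_eq, Finset.forall_mem_insert, Set.mem_sdiff]
  tauto

variable [MeasurableSpace Ω] {μ : Measure Ω}

lemma pow_mul_le_measure_avoid_union [IsFiniteMeasure μ] (hA : ∀ i, MeasurableSet (A i)) {x : ℝ} (hx1 : x ≤ 1)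
    {S T : Finset ι} (h : ∀ U, S ⊆ U → U ⊆ S ∪ T → ∀ j ∈ T, j ∉ U →
      μ.real (A j ∩ avoid A U) ≤ x * μ.real (avoid A U)) (hST : Disjoint S T) :
    (1 - x) ^ T.card * μ.real (avoid A S) ≤ μ.real (avoid A (S ∪ T)) := by
  induction T using Finset.induction_on with
  | empty => simp
  | insert j T hj ih =>
    rw [Finset.disjoint_insert_right] at hST
    have h1 := ih (fun U hU hU' k hk => h U hU (hU'.trans
      (Finset.union_subset_union_right (Finset.subset_insert _ _))) k
      (Finset.mem_insert_of_mem hk)) hST.2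
    have h2 := h (S ∪ T) Finset.subset_union_left
      (Finset.union_subset_union_right (Finset.subset_insert _ _)) j (Finset.mem_insert_self _ _)
      (by simp [hST.1, hj])
    have h3 := measureReal_inter_add_sdiff (μ := μ) (s := avoid A (S ∪ T)) (hA j)
    rw [Set.inter_comm] at h3
    rw [Finset.union_insert, avoid_insert, Finset.card_insert_of_notMem hj, pow_succ]
    have h4 := mul_le_mul_of_nonneg_left h1 (sub_nonneg.2 hx1)
    linarith

/-- The symmetric form of the Lovász local lemma, with an explicit lower bound for the probability
that none of the events occurs. The event `A i` may depend on the events `A j` with `j ∈ N i`. -/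
theorem pow_card_le_measure_avoid [IsProbabilityMeasure μ] (hA : ∀ i, MeasurableSet (A i))
    (N : ι → Finset ι) {p x : ℝ} {D : ℕ} (hx0 : 0 ≤ x) (hx1 : x ≤ 1)
    (hind : ∀ i S, Disjoint S (N i) →
      μ.real (A i ∩ avoid A S) ≤ p * μ.real (avoid A S))
    (hN : ∀ i, (N i).card ≤ D) (hp : p ≤ x * (1 - x) ^ D) (S : Finset ι) :
    (1 - x) ^ S.card ≤ μ.real (avoid A S) := by
  have key : ∀ (S : Finset ι) (i : ι), μ.real (A i ∩ avoid A S) ≤ x * μ.real (avoid A S) := by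
    intro S
    induction S using Finset.strongInduction with
    | H S ih =>
      intro i
      have hdisj : Disjoint (S \ N i) (S ∩ N i) := Finset.disjoint_sdiff_inter S (N i)
      have hun : S \ N i ∪ S ∩ N i = S := Finset.sdiff_union_inter S (N i)
      have h1 := pow_mul_le_measure_avoid_union (μ := μ) hA hx1 (S := S \ N i) (T := S ∩ N i)
        (fun U _ hU j hj hjU => ih U (by
          rw [hun] at hU
          exact (Finset.ssubset_iff_of_subset hU).2
            ⟨j, Finset.mem_of_mem_inter_left hj, hjU⟩) j) hdisj
      rw [hun] at h1
      have h2 : (1 - x) ^ D ≤ (1 - x) ^ (S ∩ N i).card :=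
        pow_le_pow_of_le_one (sub_nonneg.2 hx1) (by linarith)
          ((Finset.card_le_card Finset.inter_subset_right).trans (hN i))
      have h0 : 0 ≤ μ.real (avoid A (S \ N i)) := measureReal_nonneg
      calc μ.real (A i ∩ avoid A S) ≤ μ.real (A i ∩ avoid A (S \ N i)) :=
            measureReal_mono (Set.inter_subset_inter_right _ (avoid_anti Finset.sdiff_subset))
        _ ≤ p * μ.real (avoid A (S \ N i)) := hind i _ Finset.sdiff_disjoint
        _ ≤ x * (1 - x) ^ (S ∩ N i).card * μ.real (avoid A (S \ N i)) := by
            refine mul_le_mul_of_nonneg_right (hp.trans ?_) h0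
            gcongr
        _ ≤ x * μ.real (avoid A S) := by
            rw [mul_assoc]
            gcongr
  have h := pow_mul_le_measure_avoid_union (μ := μ) hA hx1 (S := ∅) (T := S)
    (fun U _ _ j _ _ => key U j) (Finset.disjoint_empty_left _)
  rw [Finset.empty_union] at h
  simpa [avoid] using h

end LocalLemma

/-! ### The probability that a triangle inequality fails -/

lemma lintegral_Ioi_max_pow_le (a c : ℝ) (k : ℕ) (hk : k ≠ 0) :
    ∫⁻ z in Set.Ioi a, ENNReal.ofReal (max (c - z) 0 ^ k) ≤
      ENNReal.ofReal (max (c - a) 0 ^ (k + 1) / (k + 1)) := by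
  rcases le_or_gt c a with h | h
  · have : ∫⁻ z in Set.Ioi a, ENNReal.ofReal (max (c - z) 0 ^ k) = ∫⁻ z in Set.Ioi a, 0 := by
      refine setLIntegral_congr_fun measurableSet_Ioi fun z hz => ?_
      have : c - z ≤ 0 := by have := Set.mem_Ioi.1 hz; linarith
      simp [max_eq_right this, hk]
    rw [this]
    simp
  · have h1 : ∫⁻ z in Set.Ioi c, ENNReal.ofReal (max (c - z) 0 ^ k) = 0 := by
      rw [setLIntegral_congr_fun (g := fun _ => 0) measurableSet_Ioi fun z hz => ?_]
      · simp
      · have : c - z ≤ 0 := by have := Set.mem_Ioi.1 hz; linarith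
        simp [max_eq_right this, hk]
    rw [← Set.Ioc_union_Ioi_eq_Ioi h.le, lintegral_union measurableSet_Ioi
      (Set.disjoint_left.2 fun z hz hz' => not_lt.2 hz.2 hz'), h1, add_zero,
      setLIntegral_congr_fun (g := fun z => ENNReal.ofReal ((c - z) ^ k)) measurableSet_Ioc
        fun z hz => by dsimp only; rw [max_eq_left (sub_nonneg.2 hz.2)],
      ← ofReal_integral_eq_lintegral_ofReal, ← intervalIntegral.integral_of_le h.le,
      intervalIntegral.integral_comp_sub_left (fun z => z ^ k), integral_pow,
      max_eq_left (sub_nonneg.2 h.le)]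
    · simp
    · exact (Continuous.integrableOn_Icc (by fun_prop)).mono_set Set.Ioc_subset_Icc_self
    · refine (ae_restrict_iff' measurableSet_Ioc).2 (Eventually.of_forall fun z hz => ?_)
      exact pow_nonneg (sub_nonneg.2 hz.2) k

/-- The uniform probability measure on `(1 - δ, 2]`. -/
noncomputable def uniformIoc (δ : ℝ) : Measure ℝ :=
  (ENNReal.ofReal (1 + δ))⁻¹ • volume.restrict (Set.Ioc (1 - δ) 2)

section Uniform

variable {δ : ℝ}

lemma isProbabilityMeasure_uniformIoc (hδ : 0 ≤ δ) : IsProbabilityMeasure (uniformIoc δ) := by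
  constructor
  rw [uniformIoc, Measure.smul_apply, Measure.restrict_apply_univ, Real.volume_Ioc, smul_eq_mul,
    show 2 - (1 - δ) = 1 + δ by ring]
  exact ENNReal.inv_mul_cancel (ENNReal.ofReal_pos.2 (by linarith)).ne' ENNReal.ofReal_ne_top

lemma uniformIoc_le (hδ : 0 ≤ δ) : uniformIoc δ ≤ volume.restrict (Set.Ioc (1 - δ) 2) := by
  intro s
  rw [uniformIoc, Measure.smul_apply, smul_eq_mul]
  refine mul_le_of_le_one_left zero_le (ENNReal.inv_le_one.2 ?_)
  rw [← ENNReal.ofReal_one]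
  exact ENNReal.ofReal_le_ofReal (by linarith)

/-- For three independent uniform points of `(1 - δ, 2]`, the probability that one exceeds the sum
of the two others is at most the volume of a simplex of side `2δ`. -/
lemma uniformIoc_prod_lt_le (hδ : 0 ≤ δ) :
    (((uniformIoc δ).prod (uniformIoc δ)).prod (uniformIoc δ)) {q | q.1.1 + q.1.2 < q.2} ≤
      ENNReal.ofReal (4 / 3 * δ ^ 3) := by
  have := isProbabilityMeasure_uniformIoc hδ
  have hmeas : MeasurableSet {q : (ℝ × ℝ) × ℝ | q.1.1 + q.1.2 < q.2} :=
    measurableSet_lt (by fun_prop) (by fun_prop)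
  have hle : uniformIoc δ ≤ volume.restrict (Set.Ioi (1 - δ)) :=
    (uniformIoc_le hδ).trans (Measure.restrict_mono_set _ Set.Ioc_subset_Ioi_self)
  rw [Measure.prod_apply hmeas, lintegral_prod _ (measurable_measure_prodMk_left hmeas).aemeasurable]
  calc ∫⁻ y, ∫⁻ z, uniformIoc δ (Prod.mk (y, z) ⁻¹' {q | q.1.1 + q.1.2 < q.2})
        ∂uniformIoc δ ∂uniformIoc δ
      ≤ ∫⁻ y, ∫⁻ z, ENNReal.ofReal (max (2 - y - z) 0 ^ 1) ∂uniformIoc δ ∂uniformIoc δ := by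
        refine lintegral_mono fun y => lintegral_mono fun z => ?_
        refine (uniformIoc_le hδ _).trans ?_
        rw [Measure.restrict_apply (measurable_prodMk_left hmeas), pow_one]
        have hsub : (Prod.mk (y, z) ⁻¹' {q : (ℝ × ℝ) × ℝ | q.1.1 + q.1.2 < q.2})
            ∩ Set.Ioc (1 - δ) 2 ⊆ Set.Ioc (y + z) 2 := fun w hw => ⟨hw.1, hw.2.2⟩
        refine (measure_mono hsub).trans ?_
        rw [Real.volume_Ioc]
        exact ENNReal.ofReal_le_ofReal ((le_max_left _ _).trans_eq' (by ring))
    _ ≤ (∫⁻ y, ENNReal.ofReal (max (1 + δ - y) 0 ^ 2) ∂uniformIoc δ) / 2 := by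
        rw [div_eq_mul_inv, ← lintegral_mul_const' _ _ (by simp)]
        refine lintegral_mono fun y => ?_
        refine (lintegral_mono' hle le_rfl).trans
          ((lintegral_Ioi_max_pow_le _ _ 1 one_ne_zero).trans (le_of_eq ?_))
        rw [show 2 - y - (1 - δ) = 1 + δ - y by ring, ENNReal.ofReal_div_of_pos (by norm_num)]
        norm_num [div_eq_mul_inv]
    _ ≤ ENNReal.ofReal (max (1 + δ - (1 - δ)) 0 ^ 3 / 3) / 2 := by
        gcongr
        refine (lintegral_mono' hle le_rfl).trans
          ((lintegral_Ioi_max_pow_le _ _ 2 two_ne_zero).trans (le_of_eq ?_))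
        norm_num
    _ = ENNReal.ofReal (4 / 3 * δ ^ 3) := by
        rw [show 1 + δ - (1 - δ) = 2 * δ by ring, max_eq_left (by positivity),
          ← ENNReal.ofReal_ofNat 2, ← ENNReal.ofReal_div_of_pos (by norm_num)]
        congr 1
        ring

end Uniform

/-! ### Triangles in a uniformly random array -/

/-- The choices of an unordered pair `{i, j}`, listed as `i < j`, and of a third point `k`, written
`(i, j, k)`: one for each triangle inequality `d i j ≤ d i k + d k j`. -/
abbrev Corner (n : ℕ) : Type :=
  {t : Fin n × Fin n × Fin n // t.1 < t.2.1 ∧ t.1 ≠ t.2.2 ∧ t.2.2 ≠ t.2.1}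

namespace Corner

variable {n : ℕ}

/-- The side whose length is bounded by the triangle inequality. -/
def base (t : Corner n) : PointPair n := pointPair t.2.1.ne

/-- The first of the two sides that bound the base. -/
def left (t : Corner n) : PointPair n := pointPair t.2.2.1

/-- The second of the two sides that bound the base. -/
def right (t : Corner n) : PointPair n := pointPair t.2.2.2

/-- The set of the three sides of a triangle. -/
def sides (t : Corner n) : Set (PointPair n) := {t.base, t.left, t.right}

lemma left_ne_right (t : Corner n) : t.left ≠ t.right := by
  obtain ⟨⟨i, j, k⟩, h1, h2, h3⟩ := t
  simp only at h1 h2 h3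
  have := h1.ne
  simp only [left, right, pointPair, ne_eq, Subtype.mk.injEq, Sym2.eq_iff]
  tauto

lemma left_ne_base (t : Corner n) : t.left ≠ t.base := by
  obtain ⟨⟨i, j, k⟩, h1, h2, h3⟩ := t
  simp only at h1 h2 h3
  have := h1.ne
  simp only [left, base, pointPair, ne_eq, Subtype.mk.injEq, Sym2.eq_iff]
  tauto

lemma right_ne_base (t : Corner n) : t.right ≠ t.base := by
  obtain ⟨⟨i, j, k⟩, h1, h2, h3⟩ := t
  simp only at h1 h2 h3
  have := h1.ne
  simp only [right, base, pointPair, ne_eq, Subtype.mk.injEq, Sym2.eq_iff]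
  tauto

/-- The arrays that violate the triangle inequality of `t`. -/
def violation (t : Corner n) : Set (PointPair n → ℝ) := {d | d t.left + d t.right < d t.base}

lemma measurableSet_violation (t : Corner n) : MeasurableSet t.violation :=
  measurableSet_lt (by fun_prop) (by fun_prop)

open Classical in
/-- The triangles that share a side with a given one. -/
noncomputable def neighbors (t : Corner n) : Finset (Corner n) :=
  Finset.univ.filter fun t' => ¬ Disjoint t.sides t'.sides

lemma card_neighbors_le (t : Corner n) : t.neighbors.card ≤ 27 * n := by
  classical
  set K : Finset (Fin n) := {t.1.1, t.1.2.1, t.1.2.2} with hK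
  have hK3 : K.card ≤ 3 := Finset.card_le_three
  have hKt : ∀ e ∈ t.sides, ∀ a ∈ e.1, a ∈ K := by
    rintro e (rfl | rfl | rfl) a ha <;>
    · simp only [base, left, right, pointPair, Sym2.mem_iff] at ha
      rcases ha with rfl | rfl <;> simp [hK]
  -- A triangle sharing a side with `t` has at least two of its three points in `K`.
  have hsub : t.neighbors.map (Function.Embedding.subtype _) ⊆
      (K ×ˢ K ×ˢ Finset.univ) ∪ (K ×ˢ Finset.univ ×ˢ K) ∪ (Finset.univ ×ˢ K ×ˢ K) := by
    intro p hp
    obtain ⟨t', ht', rfl⟩ := Finset.mem_map.1 hp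
    obtain ⟨e, he, he'⟩ := Set.not_disjoint_iff.1 (Finset.mem_filter.1 ht').2
    have hmem := hKt e he
    simp only [Function.Embedding.subtype_apply, Finset.mem_union, Finset.mem_product,
      Finset.mem_univ, true_and, and_true]
    rcases he' with rfl | rfl | rfl
    · exact Or.inl (Or.inl ⟨hmem _ (by simp [base, pointPair]), hmem _ (by simp [base, pointPair])⟩)
    · exact Or.inl (Or.inr ⟨hmem _ (by simp [left, pointPair]), hmem _ (by simp [left, pointPair])⟩)
    · exact Or.inr ⟨hmem _ (by simp [right, pointPair]), hmem _ (by simp [right, pointPair])⟩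
  have h := Finset.card_le_card hsub
  rw [Finset.card_map] at h
  refine h.trans ((Finset.card_union_le _ _).trans ((Nat.add_le_add_right
    (Finset.card_union_le _ _) _).trans ?_))
  simp only [Finset.card_product, Finset.card_univ, Fintype.card_fin]
  have hKK : K.card * K.card ≤ 9 := Nat.mul_le_mul hK3 hK3
  nlinarith [Nat.mul_le_mul_right n hKK]

lemma two_mul_card_le (n : ℕ) : 2 * Fintype.card (Corner n) ≤ n ^ 3 := by
  have h1 : Fintype.card (Corner n ⊕ Corner n) ≤ Fintype.card (Fin n × Fin n × Fin n) := by
    refine Fintype.card_le_of_injective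
      (Sum.elim (fun t => t.1) fun t => (t.1.2.1, t.1.1, t.1.2.2)) ?_
    rintro (⟨⟨i, j, k⟩, h⟩ | ⟨⟨i, j, k⟩, h⟩) (⟨⟨i', j', k'⟩, h'⟩ | ⟨⟨i', j', k'⟩, h'⟩) heq <;>
    simp only [Sum.elim_inl, Sum.elim_inr, Prod.mk.injEq] at heq <;>
    obtain ⟨rfl, rfl, rfl⟩ := heq
    · rfl
    · exact absurd h.1 h'.1.not_gt
    · exact absurd h.1 h'.1.not_gt
    · rfl
  simp only [Fintype.card_sum, Fintype.card_prod, Fintype.card_fin] at h1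
  calc 2 * Fintype.card (Corner n) = Fintype.card (Corner n) + Fintype.card (Corner n) := by ring
    _ ≤ n * (n * n) := h1
    _ = n ^ 3 := by ring

end Corner

/-- Independent distances that are uniform on `(1 - δ, 2]`. -/
noncomputable def uniformArray (n : ℕ) (δ : ℝ) : Measure (PointPair n → ℝ) :=
  Measure.pi fun _ => uniformIoc δ

section UniformArray

open ProbabilityTheory

variable {n : ℕ} {δ : ℝ}

lemma isProbabilityMeasure_uniformArray (hδ : 0 ≤ δ) :
    IsProbabilityMeasure (uniformArray n δ) := by
  have := isProbabilityMeasure_uniformIoc hδ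
  unfold uniformArray
  infer_instance

lemma iIndepFun_uniformArray (hδ : 0 ≤ δ) :
    iIndepFun (fun (e : PointPair n) (d : PointPair n → ℝ) => d e) (uniformArray n δ) := by
  have := isProbabilityMeasure_uniformIoc hδ
  exact iIndepFun_pi (X := fun _ => id) fun _ => aemeasurable_id

lemma map_eval_uniformArray (hδ : 0 ≤ δ) (e : PointPair n) :
    (uniformArray n δ).map (fun d => d e) = uniformIoc δ := by
  have := isProbabilityMeasure_uniformIoc hδ
  exact (measurePreserving_eval (fun _ : PointPair n => uniformIoc δ) e).map_eq

lemma uniformArray_violation_le (hδ : 0 ≤ δ) (t : Corner n) :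
    (uniformArray n δ).real t.violation ≤ 4 / 3 * δ ^ 3 := by
  have := isProbabilityMeasure_uniformIoc hδ
  have := isProbabilityMeasure_uniformArray (n := n) hδ
  have hI := iIndepFun_uniformArray (n := n) hδ
  have hm : ∀ e : PointPair n, Measurable fun d : PointPair n → ℝ => d e := by fun_prop
  have h1 := (indepFun_iff_map_prod_eq_prod_map_map (hm _).aemeasurable (hm _).aemeasurable).1
    (hI.indepFun t.left_ne_right)
  have h2 := (indepFun_iff_map_prod_eq_prod_map_map ((hm _).prodMk (hm _)).aemeasurable
    (hm _).aemeasurable).1 (hI.indepFun_prodMk hm _ _ _ t.left_ne_base t.right_ne_base)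
  rw [h1, map_eval_uniformArray hδ, map_eval_uniformArray hδ, map_eval_uniformArray hδ] at h2
  have h3 := uniformIoc_prod_lt_le hδ
  rw [← h2, Measure.map_apply (by fun_prop)
    (measurableSet_lt (by fun_prop) (by fun_prop))] at h3
  exact ENNReal.toReal_le_of_le_ofReal (by positivity) h3

lemma uniformArray_violation_inter_le (hδ : 0 ≤ δ) (t : Corner n) (S : Finset (Corner n))
    (hS : Disjoint S t.neighbors) :
    (uniformArray n δ).real (t.violation ∩ avoid Corner.violation S) ≤
      4 / 3 * δ ^ 3 * (uniformArray n δ).real (avoid Corner.violation S) := by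
  have := isProbabilityMeasure_uniformArray (n := n) hδ
  set m : PointPair n → MeasurableSpace (PointPair n → ℝ) :=
    fun e => MeasurableSpace.comap (fun d => d e) inferInstance with hm
  have hle : ∀ e, m e ≤ MeasurableSpace.pi := fun e => (measurable_pi_apply e).comap_le
  set F : Set (PointPair n) := ⋃ t' ∈ S, t'.sides with hF
  have hdisj : Disjoint t.sides F := by
    rw [hF, Set.disjoint_iUnion₂_right]
    intro t' ht'
    by_contra h
    exact Finset.disjoint_left.1 hS ht' (by simpa [Corner.neighbors] using h)
  have hind := indep_iSup_of_disjoint hle (iIndepFun_uniformArray (n := n) hδ).iIndep hdisj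
  have hviol : ∀ (t' : Corner n) (G : Set (PointPair n)), t'.sides ⊆ G →
      MeasurableSet[⨆ e ∈ G, m e] t'.violation := by
    intro t' G hG
    have hev : ∀ e ∈ G, Measurable[⨆ e ∈ G, m e] fun d : PointPair n → ℝ => d e :=
      fun e he => (comap_measurable (fun d : PointPair n → ℝ => d e)).mono
        (le_iSup₂ (f := fun e _ => m e) e he) le_rfl
    exact measurableSet_lt (mδ := ⨆ e ∈ G, m e)
      ((hev _ (hG (Or.inr (Or.inl rfl)))).add (hev _ (hG (Or.inr (Or.inr rfl)))))
      (hev _ (hG (Or.inl rfl)))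
  have hav : MeasurableSet[⨆ e ∈ F, m e] (avoid Corner.violation S) := by
    have : avoid Corner.violation S = ⋂ t' ∈ S, (Corner.violation t')ᶜ := by
      ext d; simp [avoid]
    rw [this]
    exact MeasurableSet.biInter S.countable_toSet fun t' ht' =>
      (hviol t' F (Set.subset_biUnion_of_mem (u := fun t' : Corner n => t'.sides) ht')).compl
  have h := (Indep_iff _ _ _).1 hind _ _ (hviol t _ subset_rfl) hav
  rw [measureReal_def, h, ENNReal.toReal_mul]
  exact mul_le_mul_of_nonneg_right (uniformArray_violation_le hδ t) ENNReal.toReal_nonneg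

lemma uniformArray_eq (n : ℕ) (hδ : 0 ≤ δ) : uniformArray n δ =
    (ENNReal.ofReal (1 + δ))⁻¹ ^ (n.choose 2) •
      volume.restrict (Set.univ.pi fun _ => Set.Ioc (1 - δ) 2) := by
  have := isProbabilityMeasure_uniformIoc hδ
  refine Measure.pi_eq fun s hs => ?_
  have hcard : Fintype.card (PointPair n) = n.choose 2 := by
    rw [Sym2.card_subtype_not_diag, Fintype.card_fin]
  rw [Measure.smul_apply, Measure.restrict_apply (MeasurableSet.univ_pi hs), ← Set.pi_inter_distrib,
    volume_pi_pi, smul_eq_mul, ← hcard, ← Finset.card_univ, ← Finset.prod_const,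
    ← Finset.prod_mul_distrib]
  refine Finset.prod_congr rfl fun e _ => ?_
  rw [uniformIoc, Measure.smul_apply, Measure.restrict_apply (hs e), smul_eq_mul]

/-- The arrays in the box that avoid all violations are metrics. -/
lemma uniformArray_avoid_le (hδ : 0 ≤ δ) (hδ1 : δ ≤ 1) :
    ENNReal.ofReal ((1 + δ) ^ (n.choose 2)) *
      uniformArray n δ (avoid Corner.violation Finset.univ) ≤ volume (metricPolytope n) := by
  have hpos : (0 : ℝ) < 1 + δ := by linarith
  rw [uniformArray_eq n hδ, Measure.smul_apply, smul_eq_mul, ← mul_assoc,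
    ENNReal.ofReal_pow hpos.le, ← mul_pow,
    ENNReal.mul_inv_cancel (ENNReal.ofReal_pos.2 hpos).ne' ENNReal.ofReal_ne_top, one_pow, one_mul,
    Measure.restrict_apply' (MeasurableSet.univ_pi fun _ => measurableSet_Ioc)]
  refine measure_mono ?_
  rintro d ⟨hd, hbox⟩
  have hbox' : ∀ e, 1 - δ < d e ∧ d e ≤ 2 := fun e => hbox e (Set.mem_univ e)
  have hlt : ∀ (i j k : Fin n) (hij : i ≠ j) (hik : i ≠ k) (hkj : k ≠ j), i < j →
      d (pointPair hij) ≤ d (pointPair hik) + d (pointPair hkj) := by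
    intro i j k hij hik hkj h
    exact not_lt.1 (hd ⟨(i, j, k), h, hik, hkj⟩ (Finset.mem_univ _))
  have hsymm : ∀ {i j : Fin n} (h : i ≠ j), pointPair h = pointPair h.symm :=
    fun h => Subtype.ext Sym2.eq_swap
  refine ⟨⟨fun e => by linarith [(hbox' e).1], fun i j k hij hik hkj => ?_⟩, fun e => (hbox' e).2⟩
  rcases lt_or_gt_of_ne hij with h | h
  · exact hlt i j k hij hik hkj h
  · rw [hsymm hij, hsymm hik, hsymm hkj, add_comm]
    exact hlt j i k hij.symm hkj.symm hik.symm h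

end UniformArray

/-! ### The lower bound for the volume -/

lemma one_le_volume_metricPolytope (n : ℕ) : 1 ≤ volume (metricPolytope n) := by
  have h := uniformArray_avoid_le (n := n) (δ := 0) le_rfl zero_le_one
  refine le_trans (le_of_eq ?_) h
  have := isProbabilityMeasure_uniformArray (n := n) (δ := 0) le_rfl
  have hnull : (uniformArray n 0) (avoid Corner.violation (Finset.univ : Finset (Corner n)))ᶜ = 0 := by
    have : (avoid Corner.violation (Finset.univ : Finset (Corner n)))ᶜ
        = ⋃ t : Corner n, t.violation := by
      ext d
      simp only [avoid, Set.mem_compl_iff, Set.mem_ofPred_eq, Finset.mem_univ, true_imp_iff,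
        not_forall, not_not, Set.mem_iUnion]
    rw [this, measure_iUnion_null_iff]
    intro t
    have h := uniformArray_violation_le (n := n) (δ := 0) le_rfl t
    norm_num at h
    exact (measureReal_eq_zero_iff).1 (le_antisymm h measureReal_nonneg)
  have hone := prob_compl_eq_one_iff₀ (μ := uniformArray n 0)
    (s := (avoid Corner.violation (Finset.univ : Finset (Corner n)))ᶜ)
    (NullMeasurableSet.of_null hnull)
  rw [compl_compl] at hone
  rw [hone.2 hnull]
  simp

/-- The choice `δ = 1 / (2 √n)`, for which the gain `δ n² / 2` from enlarging the box exceeds the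
expected number `(2 / 3) δ³ n³` of violated triangle inequalities by `n^{3/2} / 6`, the largest
possible value. -/
lemma exp_le_volume_metricPolytope {n : ℕ} {s : ℝ} (hs : 32 ≤ s) (hns : (n : ℝ) = s ^ 2) :
    ENNReal.ofReal (Real.exp (s ^ 3 / 6 - 2 * s ^ 2)) ≤ volume (metricPolytope n) := by
  have hs0 : 0 < s := by linarith
  set δ : ℝ := 1 / (2 * s) with hδ
  have hδ0 : 0 ≤ δ := by positivity
  have hδ1 : δ ≤ 1 := by rw [hδ, div_le_one (by positivity)]; linarith
  have := isProbabilityMeasure_uniformArray (n := n) hδ0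
  set p : ℝ := 4 / 3 * δ ^ 3 with hp
  have hp' : p = 1 / (6 * s ^ 3) := by rw [hp, hδ]; field_simp; norm_num
  have hp0 : 0 < p := by rw [hp']; positivity
  set y : ℝ := 27 * n * p with hy
  have hy' : y = 9 / (2 * s) := by rw [hy, hp', hns]; field_simp; norm_num
  have hy0 : 0 < y := by rw [hy']; positivity
  have hy5 : y ≤ 1 / 5 := by rw [hy', div_le_div_iff₀ (by positivity) (by norm_num)]; linarith
  set x : ℝ := p * (1 + 2 * y) with hx
  have hx0 : 0 < x := by positivity
  have hp2 : p ≤ 1 / 4 := by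
    rw [hp', div_le_div_iff₀ (by positivity) (by norm_num)]
    have : (32 : ℝ) ^ 3 ≤ s ^ 3 := pow_le_pow_left₀ (by norm_num) hs 3
    linarith
  have hxp : x ≤ 2 * p := by rw [hx]; nlinarith
  have hx2 : x ≤ 1 / 2 := by linarith
  have hLLL := pow_card_le_measure_avoid (μ := uniformArray n δ) (p := p) (x := x) (D := 27 * n)
    (A := Corner.violation) Corner.measurableSet_violation Corner.neighbors hx0.le (by linarith)
    (fun t S hS => uniformArray_violation_inter_le hδ0 t S hS) Corner.card_neighbors_le (by
      have hB := one_add_mul_le_pow (show (-2 : ℝ) ≤ -x by linarith) (27 * n)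
      rw [← sub_eq_add_neg] at hB
      refine le_trans ?_ (mul_le_mul_of_nonneg_left hB hx0.le)
      push_cast
      have e : x * (1 + 27 * n * -x) = p * ((1 + 2 * y) * (1 - y * (1 + 2 * y))) := by
        rw [hx, hy]; ring
      rw [e]
      refine le_mul_of_one_le_right hp0.le ?_
      nlinarith [mul_pos hy0 hy0]) Finset.univ
  refine le_trans ?_ (uniformArray_avoid_le hδ0 hδ1)
  rw [← ofReal_measureReal, ← ENNReal.ofReal_mul (by positivity)]
  refine ENNReal.ofReal_le_ofReal ?_
  refine le_trans ?_ (mul_le_mul_of_nonneg_left hLLL (by positivity))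
  rw [Finset.card_univ]
  have hx1 : 0 < 1 - x := by linarith
  rw [← Real.le_log_iff_exp_le (by positivity), Real.log_mul (by positivity) (by positivity),
    Real.log_pow, Real.log_pow]
  -- The two logarithms are estimated by `log z ≥ 1 - 1 / z`.
  have hl1 : δ - δ ^ 2 ≤ Real.log (1 + δ) := by
    refine le_trans ?_ (Real.one_sub_inv_le_log_of_pos (by positivity))
    have : (1 + δ)⁻¹ ≤ 1 - δ + δ ^ 2 := by
      rw [inv_le_iff_one_le_mul₀ (by positivity)]
      nlinarith [pow_nonneg hδ0 3]
    linarith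
  have hl2 : -(x + 2 * x ^ 2) ≤ Real.log (1 - x) := by
    refine le_trans ?_ (Real.one_sub_inv_le_log_of_pos hx1)
    have : (1 - x)⁻¹ ≤ 1 + x + 2 * x ^ 2 := by
      rw [inv_le_iff_one_le_mul₀ hx1]
      nlinarith [mul_nonneg (sq_nonneg x) (show 0 ≤ 1 - 2 * x by linarith)]
    linarith
  have hch : ((n.choose 2 : ℕ) : ℝ) = (s ^ 4 - s ^ 2) / 2 := by
    rw [Nat.cast_choose_two, hns]; ring
  have hT : (Fintype.card (Corner n) : ℝ) ≤ s ^ 6 / 2 := by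
    have h : (2 : ℝ) * Fintype.card (Corner n) ≤ (n : ℝ) ^ 3 := by
      exact_mod_cast Corner.two_mul_card_le n
    rw [hns] at h
    linarith
  have h1 : s ^ 3 / 4 - s ^ 2 / 8 - s / 4 ≤ (n.choose 2 : ℝ) * Real.log (1 + δ) := by
    have h0 : 0 ≤ (s ^ 4 - s ^ 2) / 2 := by rw [← hch]; positivity
    rw [hch]
    refine le_trans (le_of_sub_nonneg ?_) (mul_le_mul_of_nonneg_left hl1 h0)
    have : (s ^ 4 - s ^ 2) / 2 * (δ - δ ^ 2) - (s ^ 3 / 4 - s ^ 2 / 8 - s / 4) = 1 / 8 := by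
      rw [hδ]; field_simp; ring
    rw [this]; norm_num
  have h2 : -(s ^ 3 / 12 + 3 / 4 * s ^ 2 + 1 / 9) ≤
      (Fintype.card (Corner n) : ℝ) * Real.log (1 - x) := by
    have hb : x + 2 * x ^ 2 ≤ x + 8 * p ^ 2 := by
      have := pow_le_pow_left₀ hx0.le hxp 2
      linarith
    have h3 : (Fintype.card (Corner n) : ℝ) * (x + 8 * p ^ 2) ≤ s ^ 6 / 2 * (x + 8 * p ^ 2) :=
      mul_le_mul_of_nonneg_right hT (by positivity)
    have h4 : s ^ 6 / 2 * (x + 8 * p ^ 2) = s ^ 3 / 12 + 3 / 4 * s ^ 2 + 1 / 9 := by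
      rw [hx, hy', hp']; field_simp; ring
    have h5 := mul_le_mul_of_nonneg_left ((neg_le_neg hb).trans hl2)
      (Nat.cast_nonneg (α := ℝ) (Fintype.card (Corner n)))
    linarith
  nlinarith

theorem theorem1p2 :
    (∃ ε : ℕ → ℝ, Tendsto ε atTop (𝓝 0) ∧
      ∀ n : ℕ, 2 ≤ n →
        ENNReal.ofReal (Real.exp ((1 / 6 - ε n) * (n : ℝ) ^ (3 / 2 : ℝ)))
          ≤ volume (metricPolytope n)) ∧
    (∃ C : ℝ, ∀ n : ℕ, 2 ≤ n →
      volume (metricPolytope n) ≤ ENNReal.ofReal (Real.exp (C * (n : ℝ) ^ (3 / 2 : ℝ)))) := by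
  refine ⟨⟨fun n => 8 / √n, ?_, fun n hn => ?_⟩, 2048, fun n hn =>
    volume_metricPolytope_le (by omega)⟩
  · exact (Real.tendsto_sqrt_atTop.comp tendsto_natCast_atTop_atTop).const_div_atTop 8
  · have hnR : (0 : ℝ) < n := by exact_mod_cast (show 0 < n by omega)
    have hs0 : 0 < √(n : ℝ) := Real.sqrt_pos.2 hnR
    have hns : (n : ℝ) = √n ^ 2 := (Real.sq_sqrt hnR.le).symm
    have hpow : (n : ℝ) ^ (3 / 2 : ℝ) = √n ^ 3 := by
      rw [Real.sqrt_eq_rpow, ← Real.rpow_natCast, ← Real.rpow_mul hnR.le]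
      norm_num
    rw [hpow]
    have e : (1 / 6 - 8 / √(n : ℝ)) * √n ^ 3 = √n ^ 3 / 6 - 8 * √n ^ 2 := by field_simp
    rw [e]
    rcases le_total 32 (√(n : ℝ)) with h | h
    · refine le_trans (ENNReal.ofReal_le_ofReal (Real.exp_le_exp.2 ?_))
        (exp_le_volume_metricPolytope h hns)
      nlinarith
    · refine le_trans ?_ (one_le_volume_metricPolytope n)
      rw [← ENNReal.ofReal_one]
      refine ENNReal.ofReal_le_ofReal (Real.exp_le_one_iff.2 ?_)
      nlinarith [mul_nonneg (sq_nonneg √(n : ℝ)) (sub_nonneg.2 h)]
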